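/- Let $n\ge 1$ and let $\Gamma$ be a connected simple graph on the vertex set $[n]=\{1,\dots,n\}$. Write $w(i,j)$ for the product of $w\in S_n$ with the transposition $(i,j)$ on the right. The ring of splines of $\Gamma$ is $$\mathcal S_\Gamma=\bigl\{\bar\rho: S_n\to\mathbb C[t_1,\dots,t_n]\ \bigm|\ \bar\rho(w)-\bar\rho(w(i,j))\in\langle t_{w(i)}-t_{w(j)}\rangle\ \text{for all } w\in S_n,\ (i,j)\in E(\Gamma)\bigr\},$$ and $\mathcal S_\Gamma^1$ is the $\mathbb C$-vector space of those splines all of whose values are zero or homogeneous of degree $1$. A vertex $v$ is a *cut vertex* if $\Gamma-v$ (the induced subgraph on the other vertices) is disconnected; an edge is a *cut edge* if deleting it, but no vertex, disconnects $\Gamma$. Let $\mathcal F_\Gamma$ be the set of the following functions on $S_n$: - $\bar t_i(w)=t_i$ and $\bar x_i(w)=t_{w(i)}$, for $i\in[n]$; - for each cut edge $s=(i,j)$ with $i<j$ and each $A\subseteq[n]$ with $|A|=|G_s|$, where $G_s$ is the component containing $i$ of $([n],E(\Gamma)\setminus\{s\})$: $\bar f_A^s(w)=t_{w(i)}-t_{w(j)}$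 if $w^{-1}(A)=V(G_s)$, and $0$ otherwise; - for each cut vertex $j$, each connected component $G$ of $\Gamma-j$ and each $k\in[n]$: $\bar y^j_{G,k}(w)=t_k-t_{w(j)}$ if $w^{-1}(k)\in G$, and $0$ otherwise. **(1)** The $\mathbb C$-linear span of $\mathcal F_\Gamma$ is $\mathcal S_\Gamma^1$. For (2) we use the following notions. $\Gamma$ is *cliqued* if any two distinct vertices joined by two different paths with no common vertices except the end points are adjacent. A *block* is a maximal subgraph that is connected and stays connected when any one of its vertices is removed (a single edge may be a block). The *block-cut tree* has as vertices the cut vertices and the blocks of $\Gamma$, with a cut vertex $v$ joined to a block $B$ when $v\in B$. $\Gamma$ is *naturally labelled* if there are a cut vertex $v$ lying in at most one block that is not a leaf of the block-cut tree, and a block $B$ of largest size among the leaves of the block-cut tree that are adjacent to $v$, such that $V(B)=\{n-|B|+1,\dots,n\}$, $v=n-|B|+1\ne n$, and, whenever $j,k$ are both in $V(B)\setminus\{n,v\}$ or both outside $V(B)$, $d(j,n)<d(k,n)$ implies $j>k$ (with $d$ the graph distance in $\Gamma$). A pair $(i,j)$ with $i<j$ is *dominant* if $j$ is a cut vertex and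 $i$ is the largest vertex of a connected component of $\Gamma-j$ not containing $n$; this component is denoted $\Gamma_i^j$. It is *strongly dominant* if $(i,j)$ is a cut edge and *weakly dominant* otherwise. $\Gamma$ is of - *type A* if $(n-1,n)$ is a cut edge and at most one component of $\Gamma-(n-1)$ is not an isolated vertex; - *type B* if $n-2$ is a cut vertex and $\{n-2,n-1,n\}$ is the vertex set of a block; - *type C* if none of $n-2,n-1,n$ is a cut vertex and these three vertices form a clique. **(2)** If $\Gamma$ is moreover cliqued and naturally labelled, then it is of type A, B or C, and $$\dim_{\mathbb C}\mathcal S_\Gamma^1=1+\dim_{\mathbb C}\mathcal S_{\Gamma-n}^1+\epsilon+\sum_{(i,j)\text{ strongly dominant}}\binom{n-1}{|\Gamma_i^j|-1}+\#\{(i,j)\text{ weakly dominant}\},$$ where $\epsilon=\binom{n-1}{1}$ if $\Gamma$ is of type A and $\epsilon=1$ if $\Gamma$ is of type B or C. Here $\Gamma-n$ is regarded as a graph on $[n-1]$. -/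

import Mathlib

noncomputable section

namespace CayleySplines

open SimpleGraph

/-! ### Graph notions -/

section Graphs

/-- `v` is a cut vertex of `Γ`: the graph `Γ - v` is disconnected. -/
def IsCutVertex {V : Type*} (Γ : SimpleGraph V) (v : V) : Prop :=
  ¬ (Γ.induce {v}ᶜ).Preconnected

/-- `(i, j)` is a cut edge of `Γ`: it is an edge, and removing it (but no vertex) disconnects
the graph. -/
def IsCutEdge {V : Type*} (Γ : SimpleGraph V) (i j : V) : Prop :=
  Γ.Adj i j ∧ ¬ (Γ.deleteEdges {s(i, j)}).Preconnected

/-- `G` is the vertex set of a connected component of `Γ - j`. -/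
def IsComponentOfDelete {V : Type*} (Γ : SimpleGraph V) (j : V) (G : Set V) : Prop :=
  ∃ C : (Γ.induce {j}ᶜ).ConnectedComponent, G = Subtype.val '' C.supp

/-- The vertex set of the connected component of `Γ - j` that contains `i` (for `i ≠ j`). -/
def componentOfDelete {V : Type*} (Γ : SimpleGraph V) (j i : V) : Set V :=
  {k | ∃ (hi : i ∈ ({j}ᶜ : Set V)) (hk : k ∈ ({j}ᶜ : Set V)),
    (Γ.induce {j}ᶜ).Reachable ⟨i, hi⟩ ⟨k, hk⟩}

/-- The vertex set of the component containing `i` of the graph `Γ` with the edge `(i, j)`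
removed. -/
def cutEdgeComponent {V : Type*} (Γ : SimpleGraph V) (i j : V) : Set V :=
  {k | (Γ.deleteEdges {s(i, j)}).Reachable i k}

/-- A graph is 2-connected if it is connected and remains connected after removing any one
vertex. (A single edge is 2-connected in this sense.) -/
def IsTwoConnected {V : Type*} (Γ : SimpleGraph V) : Prop :=
  Γ.Connected ∧ ∀ v : V, (Γ.induce {v}ᶜ).Preconnected

/-- `B` is the vertex set of a block of `Γ`, i.e. of a maximal 2-connected subgraph. Such a subgraph
is induced, so blocks are identified with their vertex sets. -/
def IsBlock {V : Type*} (Γ : SimpleGraph V) (B : Set V) : Prop :=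
  Maximal (fun s : Set V => IsTwoConnected (Γ.induce s)) B

/-- The block-cut tree: its vertices are the cut vertices and the blocks of `Γ`, and a cut vertex
`v` is joined to a block `B` when `v ∈ B`. -/
def blockCutTree {V : Type*} (Γ : SimpleGraph V) :
    SimpleGraph ({v : V // IsCutVertex Γ v} ⊕ {B : Set V // IsBlock Γ B}) :=
  SimpleGraph.fromRel fun x y =>
    ∃ (v : {v : V // IsCutVertex Γ v}) (B : {B : Set V // IsBlock Γ B}),
      x = Sum.inl v ∧ y = Sum.inr B ∧ (v : V) ∈ (B : Set V)

/-- `B` is a leaf of the block-cut tree. -/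
def IsLeafBlock {V : Type*} (Γ : SimpleGraph V) (B : {B : Set V // IsBlock Γ B}) : Prop :=
  ((blockCutTree Γ).neighborSet (Sum.inr B)).ncard = 1

/-- `Γ` is cliqued: two vertices are adjacent as soon as they are joined by two (different) paths
that share no vertices except their end points. -/
def IsCliqued {V : Type*} (Γ : SimpleGraph V) : Prop :=
  ∀ i j : V, i ≠ j →
    (∃ p q : Γ.Path i j, p ≠ q ∧
      ∀ x, x ∈ (p : Γ.Walk i j).support → x ∈ (q : Γ.Walk i j).support → x = i ∨ x = j) →
    Γ.Adj i j

end Graphs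

/-! ### Labelled graphs

The vertex set `{1, …, n}` with `n = m + 1` is `Fin (m + 1)`; the label `k` is the element with
value `k - 1`, so that the label `n` is `Fin.last m`. -/

section Labelled

/-- `Γ` is naturally labelled. There are a cut vertex `v` lying in at most one non-leaf block and a
largest leaf block `B` at `v`, such that: `n ∈ B` and `n ≠ v`; the vertices of `B` carry the
largest `|B|` labels, and `v` carries the smallest of these (`B = {v, v + 1, …, n}`); and
vertices closer to `n` have larger labels, separately among the vertices of `B` other than
`n` and `v`, and among the vertices outside `B`. -/
def IsNaturallyLabelled {m : ℕ} (Γ : SimpleGraph (Fin (m + 1))) : Prop :=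
  ∃ (v : {v : Fin (m + 1) // IsCutVertex Γ v}) (B : {B : Set (Fin (m + 1)) // IsBlock Γ B}),
    {B' : {B : Set (Fin (m + 1)) // IsBlock Γ B} |
      (blockCutTree Γ).Adj (Sum.inl v) (Sum.inr B') ∧ ¬ IsLeafBlock Γ B'}.Subsingleton ∧
    (blockCutTree Γ).Adj (Sum.inl v) (Sum.inr B) ∧ IsLeafBlock Γ B ∧
    (∀ B' : {B : Set (Fin (m + 1)) // IsBlock Γ B},
      (blockCutTree Γ).Adj (Sum.inl v) (Sum.inr B') → IsLeafBlock Γ B' →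
        (B' : Set (Fin (m + 1))).ncard ≤ (B : Set (Fin (m + 1))).ncard) ∧
    Fin.last m ∈ (B : Set (Fin (m + 1))) ∧ Fin.last m ≠ v ∧
    (B : Set (Fin (m + 1))) = Set.Ici (v : Fin (m + 1)) ∧
    (∀ j ∈ (B : Set (Fin (m + 1))) \ {Fin.last m, (v : Fin (m + 1))},
      ∀ k ∈ (B : Set (Fin (m + 1))) \ {Fin.last m, (v : Fin (m + 1))},
        Γ.dist j (Fin.last m) < Γ.dist k (Fin.last m) → k < j) ∧
    (∀ j ∉ (B : Set (Fin (m + 1))), ∀ k ∉ (B : Set (Fin (m + 1))),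
        Γ.dist j (Fin.last m) < Γ.dist k (Fin.last m) → k < j)

/-- `(i, j)` is a dominant pair: `j` is a cut vertex, `i < j`, and `i` is the largest vertex of a
connected component of `Γ - j` that does not contain `n`. -/
def IsDominantPair {m : ℕ} (Γ : SimpleGraph (Fin (m + 1))) (i j : Fin (m + 1)) : Prop :=
  IsCutVertex Γ j ∧ i < j ∧
    ∃ G : Set (Fin (m + 1)), IsComponentOfDelete Γ j G ∧ Fin.last m ∉ G ∧ IsGreatest G i

/-- A dominant pair is strongly dominant if it is a cut edge. -/
def IsStronglyDominant {m : ℕ} (Γ : SimpleGraph (Fin (m + 1))) (i j : Fin (m + 1)) : Prop :=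
  IsDominantPair Γ i j ∧ IsCutEdge Γ i j

/-- A dominant pair is weakly dominant if it is not strongly dominant. -/
def IsWeaklyDominant {m : ℕ} (Γ : SimpleGraph (Fin (m + 1))) (i j : Fin (m + 1)) : Prop :=
  IsDominantPair Γ i j ∧ ¬ IsCutEdge Γ i j

/-- Type A: `(n - 1, n)` is a cut edge, and at most one component of `Γ - (n - 1)` is not an
isolated vertex. -/
def IsTypeA {m : ℕ} (Γ : SimpleGraph (Fin (m + 1))) : Prop :=
  ∃ a : Fin (m + 1), (a : ℕ) + 1 = m ∧ IsCutEdge Γ a (Fin.last m) ∧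
    {G : Set (Fin (m + 1)) | IsComponentOfDelete Γ a G ∧ G.ncard ≠ 1}.Subsingleton

/-- Type B: `n - 2` is a cut vertex, and `{n - 2, n - 1, n}` is a block. -/
def IsTypeB {m : ℕ} (Γ : SimpleGraph (Fin (m + 1))) : Prop :=
  ∃ a b : Fin (m + 1), (a : ℕ) + 2 = m ∧ (b : ℕ) + 1 = m ∧
    IsCutVertex Γ a ∧ IsBlock Γ {a, b, Fin.last m}

/-- Type C: none of `n - 2`, `n - 1`, `n` is a cut vertex, and these vertices form a clique. -/
def IsTypeC {m : ℕ} (Γ : SimpleGraph (Fin (m + 1))) : Prop :=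
  ∃ a b : Fin (m + 1), (a : ℕ) + 2 = m ∧ (b : ℕ) + 1 = m ∧
    ¬ IsCutVertex Γ a ∧ ¬ IsCutVertex Γ b ∧ ¬ IsCutVertex Γ (Fin.last m) ∧
    Γ.IsClique {a, b, Fin.last m}

/-- The induced subgraph `Γ - n`, as a graph on `{1, …, n - 1}`. -/
def deleteLast {m : ℕ} (Γ : SimpleGraph (Fin (m + 1))) : SimpleGraph (Fin m) :=
  Γ.comap Fin.castSucc

end Labelled

/-! ### Splines -/

section Splines

open MvPolynomial

/-- The ring of splines on the Cayley graph of `S_n` with generators the edges of `Γ`. It consists of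
the functions `ρ : S_n → ℂ[t_1, …, t_n]` such that `ρ(w) - ρ(w (i, j))` lies in the ideal
`⟨t_{w(i)} - t_{w(j)}⟩` for every permutation `w` and every edge `(i, j)` of `Γ`. -/
def splines {n : ℕ} (Γ : SimpleGraph (Fin n)) :
    Subalgebra ℂ (Equiv.Perm (Fin n) → MvPolynomial (Fin n) ℂ) where
  carrier := {ρ | ∀ (w : Equiv.Perm (Fin n)) (i j : Fin n), Γ.Adj i j →
    ρ w - ρ (w * Equiv.swap i j) ∈
      Ideal.span {(X (w i) - X (w j) : MvPolynomial (Fin n) ℂ)}}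
  add_mem' := by
    intro a b ha hb w i j h
    have := Ideal.add_mem _ (ha w i j h) (hb w i j h)
    simpa only [Pi.add_apply, add_sub_add_comm] using this
  mul_mem' := by
    intro a b ha hb w i j h
    have := Ideal.add_mem _ (Ideal.mul_mem_left _ (a w) (hb w i j h))
      (Ideal.mul_mem_left _ (b (w * Equiv.swap i j)) (ha w i j h))
    convert this using 1
    simp only [Pi.mul_apply]
    ring
  algebraMap_mem' := by
    intro r w i j _
    simp [Pi.algebraMap_apply]

/-- The degree `d` graded piece of the ring of splines, a `ℂ`-vector space. -/
def splinesOfDegree {n : ℕ} (Γ : SimpleGraph (Fin n)) (d : ℕ) :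
    Submodule ℂ (Equiv.Perm (Fin n) → MvPolynomial (Fin n) ℂ) :=
  Subalgebra.toSubmodule (splines Γ) ⊓
    Submodule.pi Set.univ (fun _ => homogeneousSubmodule (Fin n) ℂ d)

/-- The spline `t̄_i`, with `t̄_i(w) = t_i`. -/
def tBar {n : ℕ} (i : Fin n) : Equiv.Perm (Fin n) → MvPolynomial (Fin n) ℂ :=
  fun _ => X i

/-- The spline `x̄_i`, with `x̄_i(w) = t_{w(i)}`. -/
def xBar {n : ℕ} (i : Fin n) : Equiv.Perm (Fin n) → MvPolynomial (Fin n) ℂ :=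
  fun w => X (w i)

open Classical in
/-- The linear coset spline of the cut edge `s = (i, j)` and the set `A`: its value at `w` is
`t_{w(i)} - t_{w(j)}` if `w⁻¹(A) = V(G_s)`, and `0` otherwise. Here `G_s` is the component
containing `i` of the graph `Γ` with `s` removed. -/
def fBar {n : ℕ} (Γ : SimpleGraph (Fin n)) (i j : Fin n) (A : Set (Fin n)) :
    Equiv.Perm (Fin n) → MvPolynomial (Fin n) ℂ :=
  fun w => if w ⁻¹' A = cutEdgeComponent Γ i j then X (w i) - X (w j) else 0

open Classical in
/-- The spline `ȳ^j_{G,k}`: its value at `w` is `t_k - t_{w(j)}` if `w⁻¹(k) ∈ G`, and `0`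
otherwise. -/
def yBar {n : ℕ} (j : Fin n) (G : Set (Fin n)) (k : Fin n) :
    Equiv.Perm (Fin n) → MvPolynomial (Fin n) ℂ :=
  fun w => if w⁻¹ k ∈ G then X k - X (w j) else 0

/-- The linear coset splines attached to the cut edges `(i, j)`, `i < j`, of `Γ`. -/
def cosetSplines {n : ℕ} (Γ : SimpleGraph (Fin n)) :
    Set (Equiv.Perm (Fin n) → MvPolynomial (Fin n) ℂ) :=
  {ρ | ∃ (i j : Fin n) (A : Set (Fin n)), i < j ∧ IsCutEdge Γ i j ∧
    A.ncard = (cutEdgeComponent Γ i j).ncard ∧ ρ = fBar Γ i j A}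

/-- The splines `ȳ^j_{G,k}` attached to the cut vertices `j` of `Γ`, the components `G` of
`Γ - j`, and the indices `k`. -/
def cutVertexSplines {n : ℕ} (Γ : SimpleGraph (Fin n)) :
    Set (Equiv.Perm (Fin n) → MvPolynomial (Fin n) ℂ) :=
  {ρ | ∃ (j : Fin n) (G : Set (Fin n)) (k : Fin n), IsCutVertex Γ j ∧
    IsComponentOfDelete Γ j G ∧ ρ = yBar j G k}

/-- The set `F_Γ`. -/
def linearGenerators {n : ℕ} (Γ : SimpleGraph (Fin n)) :
    Set (Equiv.Perm (Fin n) → MvPolynomial (Fin n) ℂ) :=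
  Set.range tBar ∪ Set.range xBar ∪ cosetSplines Γ ∪ cutVertexSplines Γ

/-- `Σ C(n - 1, |Γ_i^j| - 1)` over the strongly dominant pairs `(i, j)`, where `n = m + 1` and
`Γ_i^j` is the component of `Γ - j` containing `i`. -/
def strongTerm {m : ℕ} (Γ : SimpleGraph (Fin (m + 1))) : ℕ :=
  ∑ᶠ p ∈ {p : Fin (m + 1) × Fin (m + 1) | IsStronglyDominant Γ p.1 p.2},
    m.choose ((componentOfDelete Γ p.2 p.1).ncard - 1)

/-- The number of weakly dominant pairs. -/
def weakTerm {m : ℕ} (Γ : SimpleGraph (Fin (m + 1))) : ℕ :=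
  {p : Fin (m + 1) × Fin (m + 1) | IsWeaklyDominant Γ p.1 p.2}.ncard

end Splines

end CayleySplines

end

noncomputable section

namespace CayleySplines

open SimpleGraph

/-! ### Deleting a vertex or an edge -/

section DeletedGraphs

variable {V : Type*} {Γ : SimpleGraph V}

/-! Write a linear spline as `ρ(w) = Σ_p a_p(w) t_{w(p)}`. Across an edge `(i, j)` the spline
condition says that `a_p` is unchanged for `p ≠ i, j`, and that `a_i + a_j` is unchanged
(`ofCoords_mem_splines_iff`). Hence `a_p` is invariant under permutations of the positions inside
each component of `Γ - p`, and the only freedom at `(i, j)` is the jump `a_j(w) - a_j(w (i, j))`.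

Fix a root `r`. For each pendant pair, a vertex `i` with a component `G` of `Γ - i` missing `r`,
choose one edge `(i, j)` with `j ∈ G`. Its jump is antisymmetric, sums to zero over the rotations of
three positions `i, j, k` (`jump_triangle`), and is invariant under the permutations that fix `i`
and `j` and preserve `G`, or under all that fix `i` and `j` when `(i, j)` is not a cut edge. So it
is a function on the edges of a Johnson graph that vanishes on triangles, hence a coboundary `u(wS)
- u(w (i, j) S)`, with `S = G` for a cut edge and `S = {j}` otherwise (`exists_jump_potential`). As
`u` matters only up to a constant, this leaves `C(n, |S|) - 1` parameters. If all chosen jumps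
vanish, each `a_p` is constant (`eq_const_of_jump_eq_zero`), which leaves `n` more. This bounds the
dimension. Conversely the coset splines and the `ȳ` realise all these jumps, triangularly with
respect to the distance from `r` (`combination_injective`). Together with the `x̄_p` they therefore
give a basis, which proves (1) and the formula `finrank_splines_eq`.

For (2) take `r = n`. The hypotheses make the last block a clique hanging from the cut vertex `v`
(`IsEndClique`), and the labelling matches dominant pairs with the pendant pairs at vertices other
than `n`. Pascal's rule splits `C(n, c) - 1` into `C(n-1, c-1)` and `C(n-1, c) - 1`. The first parts
add up to the strong and weak terms; the second parts are the terms for `Γ - n` rooted at a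
neighbour of `n`. The terms at the two roots account for `1 + ε`. -/

/-- The graph `Γ - v`, on the same vertex type, with `v` kept as an isolated vertex. -/
def isolate (Γ : SimpleGraph V) (v : V) : SimpleGraph V where
  Adj x y := Γ.Adj x y ∧ x ≠ v ∧ y ≠ v
  symm := ⟨fun _ _ h => ⟨h.1.symm, h.2.2, h.2.1⟩⟩
  loopless := ⟨fun _ h => Γ.irrefl h.1⟩

theorem isolate_adj {v x y : V} : (isolate Γ v).Adj x y ↔ Γ.Adj x y ∧ x ≠ v ∧ y ≠ v := Iff.rfl

theorem Reachable.ne_of_isolate {v x y : V} (h : (isolate Γ v).Reachable x y) (hx : x ≠ v) :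
    y ≠ v := by
  obtain ⟨p⟩ := h
  induction p with
  | nil => exact hx
  | cons h _ ih => exact ih h.2.2

theorem isolate_reachable_iff_induce {v x y : V} (hx : x ∈ ({v}ᶜ : Set V))
    (hy : y ∈ ({v}ᶜ : Set V)) :
    (Γ.induce {v}ᶜ).Reachable ⟨x, hx⟩ ⟨y, hy⟩ ↔ (isolate Γ v).Reachable x y := by
  constructor
  · intro h
    exact h.map (⟨Subtype.val, fun {a b} hab => ⟨hab, a.2, b.2⟩⟩ : Γ.induce {v}ᶜ →g isolate Γ v)
  · rintro ⟨p⟩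
    induction p with
    | nil => exact Reachable.refl _
    | cons h p ih =>
      have h1 : (Γ.induce {v}ᶜ).Adj ⟨_, hx⟩ ⟨_, h.2.2⟩ := h.1
      exact h1.reachable.trans (ih h.2.2 hy)

theorem isComponentOfDelete_iff {j : V} {G : Set V} :
    IsComponentOfDelete Γ j G ↔ ∃ x, x ≠ j ∧ G = {y | (isolate Γ j).Reachable x y} := by
  constructor
  · rintro ⟨C, rfl⟩
    induction C using ConnectedComponent.ind with
    | h x =>
      refine ⟨x.1, x.2, ?_⟩
      ext y
      simp only [Set.mem_image, ConnectedComponent.mem_supp_iff, ConnectedComponent.eq,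
        Set.mem_ofPred_eq]
      constructor
      · rintro ⟨z, hz, rfl⟩
        exact ((isolate_reachable_iff_induce z.2 x.2).1 hz).symm
      · intro h
        exact ⟨⟨y, Reachable.ne_of_isolate h x.2⟩,
          ((isolate_reachable_iff_induce _ x.2).2 h.symm), rfl⟩
  · rintro ⟨x, hx, rfl⟩
    refine ⟨(Γ.induce {j}ᶜ).connectedComponentMk ⟨x, hx⟩, ?_⟩
    ext y
    simp only [Set.mem_image, ConnectedComponent.mem_supp_iff, ConnectedComponent.eq,
        Set.mem_ofPred_eq]
    constructor
    · intro h
      exact ⟨⟨y, Reachable.ne_of_isolate h hx⟩,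
          ((isolate_reachable_iff_induce _ hx).2 h.symm), rfl⟩
    · rintro ⟨z, hz, rfl⟩
      exact ((isolate_reachable_iff_induce z.2 hx).1 hz).symm

theorem mem_componentOfDelete {j i k : V} (hi : i ≠ j) :
    k ∈ componentOfDelete Γ j i ↔ (isolate Γ j).Reachable i k := by
  constructor
  · rintro ⟨_, hk, h⟩
    exact (isolate_reachable_iff_induce hi hk).1 h
  · intro h
    have hk := Reachable.ne_of_isolate h hi
    exact ⟨hi, hk, (isolate_reachable_iff_induce hi hk).2 h⟩

theorem isCutVertex_iff {v : V} :
    IsCutVertex Γ v ↔ ∃ x y, x ≠ v ∧ y ≠ v ∧ ¬ (isolate Γ v).Reachable x y := by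
  unfold IsCutVertex Preconnected
  push Not
  constructor
  · rintro ⟨x, y, h⟩
    exact ⟨x, y, x.2, y.2, fun h' => h ((isolate_reachable_iff_induce x.2 y.2).2 h')⟩
  · rintro ⟨x, y, hx, hy, h⟩
    exact ⟨⟨x, hx⟩, ⟨y, hy⟩, fun h' => h ((isolate_reachable_iff_induce hx hy).1 h')⟩

namespace IsComponentOfDelete

variable {i : V} {G : Set V}

theorem notMem (h : IsComponentOfDelete Γ i G) : i ∉ G := by
  obtain ⟨x, hx, rfl⟩ := isComponentOfDelete_iff.1 h
  exact fun h' => Reachable.ne_of_isolate h' hx rfl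

theorem ne_of_mem (h : IsComponentOfDelete Γ i G) {x : V} (hx : x ∈ G) : x ≠ i := by
  rintro rfl
  exact h.notMem hx

theorem mem_iff (h : IsComponentOfDelete Γ i G) {x y : V} (hx : x ∈ G) :
    y ∈ G ↔ (isolate Γ i).Reachable x y := by
  obtain ⟨z, hz, rfl⟩ := isComponentOfDelete_iff.1 h
  exact ⟨fun hy => Reachable.trans (Reachable.symm hx) hy, fun hy => Reachable.trans hx hy⟩

theorem eq_setOf (h : IsComponentOfDelete Γ i G) {x : V} (hx : x ∈ G) :
    G = {y | (isolate Γ i).Reachable x y} :=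
  Set.ext fun _ => h.mem_iff hx

theorem eq_of_mem (h : IsComponentOfDelete Γ i G) {G' : Set V} (h' : IsComponentOfDelete Γ i G')
    {x : V} (hx : x ∈ G) (hx' : x ∈ G') : G = G' := by
  rw [h.eq_setOf hx, h'.eq_setOf hx']

theorem nonempty (h : IsComponentOfDelete Γ i G) : G.Nonempty := by
  obtain ⟨z, hz, rfl⟩ := isComponentOfDelete_iff.1 h
  exact ⟨z, Reachable.refl _⟩

theorem mem_of_adj (h : IsComponentOfDelete Γ i G) {x y : V} (hx : x ∈ G) (hxy : Γ.Adj x y)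
    (hy : y ≠ i) : y ∈ G := by
  have hxi : x ≠ i := fun e => h.notMem (e ▸ hx)
  exact (h.mem_iff hx).2 (Adj.reachable (G := isolate Γ i) ⟨hxy, hxi, hy⟩)

theorem exists_adj (h : IsComponentOfDelete Γ i G) (hΓ : Γ.Connected) : ∃ j ∈ G, Γ.Adj i j := by
  obtain ⟨x, hx⟩ := h.nonempty
  obtain ⟨p⟩ := hΓ.preconnected x i
  induction p with
  | nil => exact absurd hx h.notMem
  | @cons a b c hab p ih =>
    by_cases hb : b = c
    · subst hb
      exact ⟨a, hx, hab.symm⟩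
    · exact ih h (h.mem_of_adj hx hab hb)

end IsComponentOfDelete

theorem isComponentOfDelete_setOf {i x : V} (hx : x ≠ i) :
    IsComponentOfDelete Γ i {y | (isolate Γ i).Reachable x y} :=
  isComponentOfDelete_iff.2 ⟨x, hx, rfl⟩

/-- A walk from `x` to `i` either avoids `j` or contains a first visit to `j`, before which `i` can
be avoided. This dichotomy lets every jump be computed at whichever end of the edge is convenient.
-/
theorem reachable_isolate_or {i j : V} (hΓ : Γ.Connected) (hij : i ≠ j) (x : V) :
    (isolate Γ i).Reachable x j ∨ (isolate Γ j).Reachable x i := by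
  obtain ⟨p⟩ := hΓ.preconnected x i
  induction p with
  | nil => exact Or.inr (Reachable.refl _)
  | @cons a b c hab p ih =>
    by_cases haj : a = j
    · exact Or.inl (haj ▸ Reachable.refl _)
    by_cases hac : a = c
    · exact Or.inr (hac ▸ Reachable.refl _)
    rcases ih hij with h | h
    · by_cases hb : b = c
      · subst hb
        exact Or.inr (Adj.reachable (G := isolate Γ j) ⟨hab, haj, hij⟩)
      · exact Or.inl ((Adj.reachable (G := isolate Γ c) ⟨hab, hac, hb⟩).trans h)
    · by_cases hb : b = j
      · subst hb
        exact Or.inl (Adj.reachable (G := isolate Γ c) ⟨hab, hac, hij.symm⟩)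
      · exact Or.inr ((Adj.reachable (G := isolate Γ j) ⟨hab, haj, hb⟩).trans h)

/-- A shortest walk from `x` to `r` must pass through `i`, and its remainder from there is strictly
shorter. -/
theorem dist_lt_of_not_reachable_isolate {i x r : V} (hΓ : Γ.Connected) (hx : x ≠ i)
    (h : ¬ (isolate Γ i).Reachable x r) : Γ.dist i r < Γ.dist x r := by
  obtain ⟨p, hp⟩ := hΓ.exists_walk_length_eq_dist x r
  rw [← hp]
  clear hp
  induction p with
  | nil => exact absurd (Reachable.refl _) h
  | @cons a b c hab p ih =>
    rw [Walk.length_cons]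
    by_cases hb : b = i
    · subst hb
      exact Nat.lt_succ_of_le (dist_le p)
    · have := ih hb fun h' => h ((Adj.reachable (G := isolate Γ i) ⟨hab, hx, hb⟩).trans h')
      omega

theorem IsComponentOfDelete.dist_lt {i r x : V} {G : Set V} (hΓ : Γ.Connected)
    (h : IsComponentOfDelete Γ i G) (hr : r ∉ G) (hx : x ∈ G) : Γ.dist i r < Γ.dist x r :=
  dist_lt_of_not_reachable_isolate hΓ (fun e => h.notMem (e ▸ hx))
    fun h' => hr ((h.mem_iff hx).2 h')

/-! ### Cut edges -/

/-- Deleting one edge of a connected graph can only disconnect it by separating the two ends of that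
edge. -/
theorem isCutEdge_iff {i j : V} (hΓ : Γ.Connected) (hij : Γ.Adj i j) :
    IsCutEdge Γ i j ↔ ¬ (Γ.deleteEdges {s(i, j)}).Reachable i j := by
  constructor
  · intro h h'
    refine h.2 (Connected.preconnected ?_)
    by_contra hc
    exact hc (hΓ.connected_delete_edge_of_not_isBridge (fun hb => hb h'))
  · exact fun h => ⟨hij, fun h' => h (h' i j)⟩

theorem isolate_le_deleteEdges_left (i j : V) : isolate Γ i ≤ Γ.deleteEdges {s(i, j)} := by
  intro x y h
  rw [deleteEdges_adj]
  refine ⟨h.1, ?_⟩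
  simp only [Set.mem_singleton_iff, Sym2.eq_iff, not_or, not_and]
  exact ⟨fun e => absurd e h.2.1, fun _ e => h.2.2 e⟩

theorem isolate_le_deleteEdges_right (i j : V) : isolate Γ j ≤ Γ.deleteEdges {s(i, j)} := by
  rw [Sym2.eq_swap]
  exact isolate_le_deleteEdges_left j i

theorem isCutEdge_comm {i j : V} : IsCutEdge Γ i j ↔ IsCutEdge Γ j i := by
  unfold IsCutEdge
  rw [adj_comm, Sym2.eq_swap]

theorem reachable_isolate_of_notMem_support {H : SimpleGraph V} (hH : H ≤ Γ) {i x y : V}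
    (p : H.Walk x y) (hp : i ∉ p.support) : (isolate Γ i).Reachable x y := by
  induction p with
  | nil => exact Reachable.refl _
  | @cons a b c hab q ih =>
    rw [Walk.support_cons, List.mem_cons, not_or] at hp
    have hb : b ≠ i := by
      rintro rfl
      exact hp.2 q.start_mem_support
    exact (Adj.reachable (G := isolate Γ i) ⟨hH hab, Ne.symm hp.1, hb⟩).trans (ih hp.2)

/-- A path from `i` to `j` that does not use the edge leaves `i` by another neighbour and never
returns to `i`. -/
theorem exists_adj_of_reachable_deleteEdges {i j : V} (hij : i ≠ j)
    (h : (Γ.deleteEdges {s(i, j)}).Reachable i j) :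
    ∃ k, k ≠ j ∧ Γ.Adj i k ∧ (isolate Γ i).Reachable k j := by
  obtain ⟨p, hp⟩ := h.exists_isPath
  cases p with
  | nil => exact absurd rfl hij
  | @cons _ k _ hik q =>
    rw [Walk.cons_isPath_iff] at hp
    rw [deleteEdges_adj] at hik
    refine ⟨k, ?_, hik.1, reachable_isolate_of_notMem_support (deleteEdges_le _) q hp.2⟩
    rintro rfl
    exact hik.2 rfl

/-- An edge from `i` into a component of `Γ - i` is a cut edge exactly when it is the only one. -/
theorem IsComponentOfDelete.isCutEdge_iff {i j : V} {G : Set V} (hΓ : Γ.Connected)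
    (h : IsComponentOfDelete Γ i G) (hj : j ∈ G) (hij : Γ.Adj i j) :
    IsCutEdge Γ i j ↔ ∀ q ∈ G, Γ.Adj i q → q = j := by
  rw [CayleySplines.isCutEdge_iff hΓ hij]
  constructor
  · intro hc q hq hiq
    by_contra hqj
    refine hc (Reachable.trans (v := q) (Adj.reachable ?_)
      (((h.mem_iff hq).1 hj).mono (isolate_le_deleteEdges_left i j)))
    rw [deleteEdges_adj]
    refine ⟨hiq, ?_⟩
    simp only [Set.mem_singleton_iff, Sym2.eq_iff, not_or, not_and]
    exact ⟨fun _ => hqj, fun e => absurd e hij.ne⟩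
  · intro hu hc
    obtain ⟨k, hkj, hik, hk⟩ := exists_adj_of_reachable_deleteEdges hij.ne hc
    exact hkj (hu k ((h.mem_iff hj).2 hk.symm) hik)

/-- Across a cut edge `(i, j)`, the side of `j` is the component of `Γ - i` containing `j`. -/
theorem IsComponentOfDelete.cutEdgeComponent_eq {i j : V} {G : Set V} (hΓ : Γ.Connected)
    (h : IsComponentOfDelete Γ i G) (hj : j ∈ G) (hc : IsCutEdge Γ i j) :
    cutEdgeComponent Γ j i = G := by
  ext k
  rw [h.mem_iff hj]
  have hn := (CayleySplines.isCutEdge_iff hΓ hc.1).1 hc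
  constructor
  · intro hk
    have hk : (Γ.deleteEdges {s(i, j)}).Reachable j k := by rw [Sym2.eq_swap]; exact hk
    obtain ⟨p⟩ := hk
    refine reachable_isolate_of_notMem_support (deleteEdges_le _) p fun hi => hn ?_
    classical
    exact ⟨(p.takeUntil i hi).reverse⟩
  · intro hk
    exact hk.mono (isolate_le_deleteEdges_right j i)

theorem IsComponentOfDelete.cutEdgeComponent_eq_compl {i j : V} {G : Set V} (hΓ : Γ.Connected)
    (h : IsComponentOfDelete Γ i G) (hj : j ∈ G) (hc : IsCutEdge Γ i j) :
    cutEdgeComponent Γ i j = Gᶜ := by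
  have hn := (CayleySplines.isCutEdge_iff hΓ hc.1).1 hc
  ext k
  rw [Set.mem_compl_iff]
  constructor
  · intro hk hkG
    exact hn (Reachable.trans hk
      (((h.mem_iff hkG).1 hj).mono (isolate_le_deleteEdges_left i j)))
  · intro hkG
    rcases reachable_isolate_or hΓ hc.1.ne k with h1 | h1
    · exact absurd ((h.mem_iff hj).2 h1.symm) hkG
    · exact (h1.symm.mono (isolate_le_deleteEdges_right i j))

theorem cutEdgeComponent_mem_iff {i j x y : V} (hxy : Γ.Adj x y) (hne : s(x, y) ≠ s(i, j)) :
    x ∈ cutEdgeComponent Γ i j ↔ y ∈ cutEdgeComponent Γ i j := by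
  have h : (Γ.deleteEdges {s(i, j)}).Adj x y := by
    rw [deleteEdges_adj]
    exact ⟨hxy, hne⟩
  exact ⟨fun hx => Reachable.trans hx h.reachable, fun hy => Reachable.trans hy h.symm.reachable⟩

end DeletedGraphs

/-! ### Coordinates of linear splines -/

section Coordinates

open MvPolynomial Equiv

variable {n : ℕ}

/-- The family of linear forms whose coefficient of `t_{w(p)}` at `w` is `a p w`. -/
def ofCoords : (Fin n → Perm (Fin n) → ℂ) →ₗ[ℂ] (Perm (Fin n) → MvPolynomial (Fin n) ℂ) where
  toFun a := fun w => ∑ p, a p w • X (w p)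
  map_add' a b := by
    funext w
    simp only [Pi.add_apply, add_smul, Finset.sum_add_distrib]
  map_smul' c a := by
    funext w
    simp only [Pi.smul_apply, smul_eq_mul, mul_smul, Finset.smul_sum, RingHom.id_apply]

theorem ofCoords_apply (a : Fin n → Perm (Fin n) → ℂ) (w : Perm (Fin n)) :
    ofCoords a w = ∑ p, a p w • X (w p) := rfl

/-- The coordinates of the linear splines of `Γ`. -/
def coordSplines (Γ : SimpleGraph (Fin n)) : Submodule ℂ (Fin n → Perm (Fin n) → ℂ) where
  carrier := {a | ∀ i j, Γ.Adj i j → ∀ w,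
    (∀ p, p ≠ i → p ≠ j → a p (w * swap i j) = a p w) ∧
      a i (w * swap i j) + a j (w * swap i j) = a i w + a j w}
  add_mem' := by
    intro a b ha hb i j hij w
    refine ⟨fun p hi hj => ?_, ?_⟩
    · simp only [Pi.add_apply, (ha i j hij w).1 p hi hj, (hb i j hij w).1 p hi hj]
    · have h1 := (ha i j hij w).2
      have h2 := (hb i j hij w).2
      simp only [Pi.add_apply]
      linear_combination h1 + h2
  zero_mem' := by
    intro i j hij w
    simp
  smul_mem' := by
    intro c a ha i j hij w
    refine ⟨fun p hi hj => ?_, ?_⟩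
    · simp only [Pi.smul_apply, (ha i j hij w).1 p hi hj]
    · have h1 := (ha i j hij w).2
      simp only [Pi.smul_apply, smul_eq_mul]
      linear_combination c * h1

theorem eval_sum_smul_X (b : Fin n → ℂ) (w : Perm (Fin n)) (e : Fin n → ℂ) :
    eval (fun k => e (w.symm k)) (∑ p, b p • X (w p)) = ∑ p, b p * e p := by
  simp [map_sum, smul_eval]

theorem sum_smul_X_mem_span_iff (b : Fin n → ℂ) (w : Perm (Fin n)) {i j : Fin n} (hij : i ≠ j) :
    ∑ p, b p • X (w p) ∈ Ideal.span {(X (w i) - X (w j) : MvPolynomial (Fin n) ℂ)} ↔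
      (∀ p, p ≠ i → p ≠ j → b p = 0) ∧ b i + b j = 0 := by
  rw [Ideal.mem_span_singleton]
  constructor
  · rintro ⟨q, hq⟩
    -- Evaluate at points where `t_{w(i)} = t_{w(j)}`; indicator vectors of `p` and of `{i, j}` then
    -- isolate the coefficients.
    have key : ∀ e : Fin n → ℂ, e i = e j → ∑ p, b p * e p = 0 := by
      intro e he
      rw [← eval_sum_smul_X b w, hq]
      simp [he]
    constructor
    · intro p hpi hpj
      have := key (Pi.single p 1) (by simp [hpi.symm, hpj.symm])
      simpa [Pi.single_apply] using this
    · have := key (Pi.single i 1 + Pi.single j 1) (by simp [hij, hij.symm])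
      simpa [Pi.single_apply, mul_add, Finset.sum_add_distrib] using this
  · rintro ⟨h1, h2⟩
    refine ⟨C (b i), ?_⟩
    rw [Finset.sum_eq_add_of_mem i j (Finset.mem_univ _) (Finset.mem_univ _) hij]
    · have : b j = - b i := by linear_combination h2
      rw [this, MvPolynomial.smul_eq_C_mul, MvPolynomial.smul_eq_C_mul, map_neg]
      ring
    · intro p _ hp
      rw [h1 p hp.1 hp.2, zero_smul]

theorem ofCoords_injective : Function.Injective (ofCoords (n := n)) := by
  rw [← LinearMap.ker_eq_bot, LinearMap.ker_eq_bot']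
  intro a ha
  funext p w
  have h := eval_sum_smul_X (fun p => a p w) w (Pi.single p 1)
  rw [← ofCoords_apply a w, ha] at h
  simpa [Pi.single_apply] using h.symm

/-- Reindexing the second sum by the transposition expresses both values in the same variables `X (w
p)`. -/
theorem ofCoords_sub_swap (a : Fin n → Perm (Fin n) → ℂ) (w : Perm (Fin n)) (i j : Fin n) :
    ofCoords a w - ofCoords a (w * swap i j) =
      ∑ p, (a p w - a (swap i j p) (w * swap i j)) • X (w p) := by
  rw [ofCoords_apply, ofCoords_apply]
  have : ∑ p, a p (w * swap i j) • (X ((w * swap i j) p) : MvPolynomial (Fin n) ℂ) =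
      ∑ p, a (swap i j p) (w * swap i j) • X (w p) := by
    rw [← Equiv.sum_comp (swap i j)]
    simp
  rw [this, ← Finset.sum_sub_distrib]
  simp only [sub_smul]

theorem ofCoords_mem_splines_iff {Γ : SimpleGraph (Fin n)} {a : Fin n → Perm (Fin n) → ℂ} :
    ofCoords a ∈ splines Γ ↔ a ∈ coordSplines Γ := by
  have hm : ofCoords a ∈ splines Γ ↔ ∀ (w : Perm (Fin n)) (i j : Fin n), Γ.Adj i j →
      ofCoords a w - ofCoords a (w * swap i j) ∈
        Ideal.span {(X (w i) - X (w j) : MvPolynomial (Fin n) ℂ)} := Iff.rfl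
  have hm' : a ∈ coordSplines Γ ↔ ∀ i j, Γ.Adj i j → ∀ w,
      (∀ p, p ≠ i → p ≠ j → a p (w * swap i j) = a p w) ∧
      a i (w * swap i j) + a j (w * swap i j) = a i w + a j w := Iff.rfl
  rw [hm, hm']
  have key : ∀ (w : Perm (Fin n)) (i j : Fin n), Γ.Adj i j →
      (ofCoords a w - ofCoords a (w * swap i j) ∈
        Ideal.span {(X (w i) - X (w j) : MvPolynomial (Fin n) ℂ)} ↔
      (∀ p, p ≠ i → p ≠ j → a p (w * swap i j) = a p w) ∧
      a i (w * swap i j) + a j (w * swap i j) = a i w + a j w) := by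
    intro w i j hij
    rw [ofCoords_sub_swap, sum_smul_X_mem_span_iff _ _ hij.ne]
    refine and_congr (forall_congr' fun p => forall_congr' fun h1 => forall_congr' fun h2 => ?_) ?_
    · rw [swap_apply_of_ne_of_ne h1 h2, sub_eq_zero, eq_comm]
    · rw [swap_apply_left, swap_apply_right]
      constructor <;> intro h <;> linear_combination -h
  exact ⟨fun h i j hij w => (key w i j hij).1 (h w i j hij),
    fun h w i j hij => (key w i j hij).2 (h i j hij w)⟩

theorem splinesOfDegree_one_eq_map (Γ : SimpleGraph (Fin n)) :
    splinesOfDegree Γ 1 = (coordSplines Γ).map ofCoords := by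
  ext ρ
  rw [Submodule.mem_map]
  constructor
  · rintro ⟨h1, h2⟩
    have h3 : ∀ w, ρ w ∈ homogeneousSubmodule (Fin n) ℂ 1 := fun w => h2 w (Set.mem_univ _)
    have h4 : ∀ w, ∃ c : Fin n → ℂ, ∑ k, c k • X k = ρ w := by
      intro w
      have := h3 w
      rwa [homogeneousSubmodule_one_eq_span_X, Submodule.mem_span_range_iff_exists_fun] at this
    choose c hc using h4
    have h5 : ofCoords (fun p w => c w (w p)) = ρ := by
      funext w
      rw [ofCoords_apply, ← hc w]
      exact Equiv.sum_comp w (fun k => c w k • (X k : MvPolynomial (Fin n) ℂ))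
    refine ⟨_, ofCoords_mem_splines_iff.1 ?_, h5⟩
    rw [h5]
    exact h1
  · rintro ⟨a, ha, rfl⟩
    refine ⟨ofCoords_mem_splines_iff.2 ha, fun w _ => ?_⟩
    rw [ofCoords_apply]
    refine Submodule.sum_mem _ fun p _ => Submodule.smul_mem _ _ ?_
    exact isHomogeneous_X _ _

theorem finrank_splinesOfDegree_one (Γ : SimpleGraph (Fin n)) :
    Module.finrank ℂ (splinesOfDegree Γ 1) = Module.finrank ℂ (coordSplines Γ) := by
  rw [splinesOfDegree_one_eq_map]
  exact ((coordSplines Γ).equivMapOfInjective ofCoords ofCoords_injective).finrank_eq.symm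

/-! ### The generators are splines -/

theorem X_sub_X_mem_span (x y : Fin n) :
    (X x - X y : MvPolynomial (Fin n) ℂ) ∈ Ideal.span {(X x - X y : MvPolynomial (Fin n) ℂ)} :=
  Ideal.mem_span_singleton_self _

theorem span_X_sub_X_comm (x y : Fin n) :
    Ideal.span {(X x - X y : MvPolynomial (Fin n) ℂ)} =
      Ideal.span {(X y - X x : MvPolynomial (Fin n) ℂ)} := by
  rw [← Ideal.span_singleton_neg, neg_sub]

theorem tBar_mem (Γ : SimpleGraph (Fin n)) (k : Fin n) : tBar k ∈ splines Γ := by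
  intro w i j _
  simp [tBar]

theorem xBar_mem (Γ : SimpleGraph (Fin n)) (p : Fin n) : xBar p ∈ splines Γ := by
  intro w i j _
  simp only [xBar, Perm.mul_apply]
  by_cases hi : p = i
  · subst hi
    rw [swap_apply_left]
    exact X_sub_X_mem_span _ _
  by_cases hj : p = j
  · subst hj
    rw [swap_apply_right, span_X_sub_X_comm]
    exact X_sub_X_mem_span _ _
  · rw [swap_apply_of_ne_of_ne hi hj, sub_self]
    exact zero_mem _

/-- Across the cut edge itself both values are multiples of the required difference. Any other edge
lies on one side of the cut, so it does not affect whether `w⁻¹(A)` is that side. -/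
theorem fBar_mem {Γ : SimpleGraph (Fin n)} (i j : Fin n) (A : Set (Fin n)) :
    fBar Γ i j A ∈ splines Γ := by
  intro w p q hpq
  by_cases he : s(p, q) = s(i, j)
  · have h1 : ∀ w : Perm (Fin n),
        fBar Γ i j A w ∈ Ideal.span {(X (w p) - X (w q) : MvPolynomial (Fin n) ℂ)} := by
      intro w
      unfold fBar
      split_ifs
      · rcases Sym2.eq_iff.1 he with ⟨rfl, rfl⟩ | ⟨rfl, rfl⟩
        · exact X_sub_X_mem_span _ _
        · rw [span_X_sub_X_comm]
          exact X_sub_X_mem_span _ _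
      · exact zero_mem _
    refine sub_mem (h1 w) ?_
    have h2 := h1 (w * swap p q)
    rw [Perm.mul_apply, Perm.mul_apply, swap_apply_left, swap_apply_right,
      span_X_sub_X_comm] at h2
    exact h2
  · have hc : ((w * swap p q : Perm (Fin n)) ⁻¹' A = cutEdgeComponent Γ i j) ↔
        (w ⁻¹' A = cutEdgeComponent Γ i j) := by
      have hs : swap p q ⁻¹' cutEdgeComponent Γ i j = cutEdgeComponent Γ i j := by
        ext x
        rw [Set.mem_preimage]
        rcases eq_or_ne x p with rfl | hp
        · rw [swap_apply_left]
          exact (cutEdgeComponent_mem_iff hpq he).symm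
        rcases eq_or_ne x q with rfl | hq
        · rw [swap_apply_right]
          exact cutEdgeComponent_mem_iff hpq he
        · rw [swap_apply_of_ne_of_ne hp hq]
      rw [Perm.coe_mul, Set.preimage_comp]
      constructor
      · intro h
        rw [← hs, ← h, ← Set.preimage_comp, ← Perm.coe_mul, swap_mul_self, Perm.coe_one,
          Set.preimage_id]
      · intro h
        rw [h, hs]
    unfold fBar
    by_cases hw : w ⁻¹' A = cutEdgeComponent Γ i j
    · rw [if_pos hw, if_pos (hc.2 hw)]
      have h1 := xBar_mem Γ i w p q hpq
      have h2 := xBar_mem Γ j w p q hpq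
      have h3 := sub_mem h1 h2
      simp only [xBar] at h3
      convert h3 using 1
      ring
    · rw [if_neg hw, if_neg (fun h => hw (hc.1 h)), sub_zero]
      exact zero_mem _

/-- Only an edge at `j` can move the position of `k` into or out of `G`. When such an edge carries
`k`, each of the two values is zero or plus or minus the difference generating the ideal. -/
theorem yBar_mem {Γ : SimpleGraph (Fin n)} {j : Fin n} {G : Set (Fin n)}
    (hG : IsComponentOfDelete Γ j G) (k : Fin n) : yBar j G k ∈ splines Γ := by
  intro w p q hpq
  have hinv : (w * swap p q)⁻¹ k = swap p q (w⁻¹ k) := by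
    rw [mul_inv_rev, swap_inv, Perm.mul_apply]
  have key : ∀ {p q : Fin n}, p = j → Γ.Adj p q → ∀ w : Perm (Fin n), w⁻¹ k = p ∨ w⁻¹ k = q →
      yBar j G k w ∈ Ideal.span {(X (w p) - X (w q) : MvPolynomial (Fin n) ℂ)} := by
    rintro p q rfl hpq w hw
    unfold yBar
    split_ifs with hk
    · have : w⁻¹ k = q := hw.resolve_left fun h => hG.notMem (h ▸ hk)
      have hk' : k = w q := by rw [← this]; simp
      rw [hk', span_X_sub_X_comm]
      exact X_sub_X_mem_span _ _
    · exact zero_mem _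
  by_cases hk : w⁻¹ k = p ∨ w⁻¹ k = q
  · by_cases hp : p = j
    · refine sub_mem (key hp hpq w hk) ?_
      have h2 := key hp hpq (w * swap p q) (by
        rw [hinv]
        rcases hk with h | h
        · rw [h, swap_apply_left]; exact Or.inr rfl
        · rw [h, swap_apply_right]; exact Or.inl rfl)
      rw [Perm.mul_apply, Perm.mul_apply, swap_apply_left, swap_apply_right,
        span_X_sub_X_comm] at h2
      exact h2
    by_cases hq : q = j
    · have h1 := key hq hpq.symm w hk.symm
      rw [span_X_sub_X_comm] at h1
      refine sub_mem h1 ?_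
      have h2 := key hq hpq.symm (w * swap p q) (by
        rw [hinv]
        rcases hk with h | h
        · rw [h, swap_apply_left]; exact Or.inl rfl
        · rw [h, swap_apply_right]; exact Or.inr rfl)
      rw [Perm.mul_apply, Perm.mul_apply, swap_apply_left, swap_apply_right] at h2
      exact h2
    · have hc : (w * swap p q)⁻¹ k ∈ G ↔ w⁻¹ k ∈ G := by
        rw [hinv]
        rcases hk with h | h
        · rw [h, swap_apply_left]
          exact ⟨fun h => hG.mem_of_adj h hpq.symm hp, fun h => hG.mem_of_adj h hpq hq⟩
        · rw [h, swap_apply_right]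
          exact ⟨fun h => hG.mem_of_adj h hpq hq, fun h => hG.mem_of_adj h hpq.symm hp⟩
      unfold yBar
      rw [Perm.mul_apply, swap_apply_of_ne_of_ne (Ne.symm hp) (Ne.symm hq)]
      by_cases h : w⁻¹ k ∈ G
      · rw [if_pos h, if_pos (hc.2 h), sub_self]
        exact zero_mem _
      · rw [if_neg h, if_neg (fun h' => h (hc.1 h')), sub_self]
        exact zero_mem _
  · push Not at hk
    have hc : (w * swap p q)⁻¹ k = w⁻¹ k := by
      rw [hinv, swap_apply_of_ne_of_ne hk.1 hk.2]
    unfold yBar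
    rw [hc]
    split_ifs with h
    · have h1 := sub_mem (tBar_mem Γ k w p q hpq) (xBar_mem Γ j w p q hpq)
      simp only [tBar, xBar] at h1
      convert h1 using 1
      ring
    · rw [sub_zero]
      exact zero_mem _

theorem span_linearGenerators_le (Γ : SimpleGraph (Fin n)) :
    Submodule.span ℂ (linearGenerators Γ) ≤ splinesOfDegree Γ 1 := by
  have hX : ∀ k : Fin n, (X k : MvPolynomial (Fin n) ℂ) ∈ homogeneousSubmodule (Fin n) ℂ 1 :=
    fun k => isHomogeneous_X _ _
  rw [Submodule.span_le]
  rintro ρ (((⟨k, rfl⟩ | ⟨k, rfl⟩) | ⟨i, j, A, -, -, -, rfl⟩) | ⟨j, G, k, -, hG, rfl⟩)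
  · exact ⟨tBar_mem Γ k, fun w _ => hX k⟩
  · exact ⟨xBar_mem Γ k, fun w _ => hX (w k)⟩
  · refine ⟨fBar_mem i j A, fun w _ => ?_⟩
    unfold fBar
    split_ifs
    · exact sub_mem (hX _) (hX _)
    · exact zero_mem _
  · refine ⟨yBar_mem hG k, fun w _ => ?_⟩
    unfold yBar
    split_ifs
    · exact sub_mem (hX _) (hX _)
    · exact zero_mem _

end Coordinates

/-! ### Invariance under permutations of the positions -/

section Invariance

open Equiv

/-- The transpositions along the edges of a graph generate all permutations that preserve its
components. All invariance arguments below reduce to transpositions in this way. -/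
theorem mem_subgroup_of_forall_reachable {α : Type*} [DecidableEq α] [Finite α]
    (K : Subgroup (Perm α)) (H : SimpleGraph α) (hK : ∀ x y, H.Adj x y → swap x y ∈ K)
    {σ : Perm α} (hσ : ∀ x, H.Reachable x (σ x)) : σ ∈ K := by
  have hle : Subgroup.closure {τ : Perm α | ∃ x y, H.Adj x y ∧ τ = swap x y} ≤ K := by
    rw [Subgroup.closure_le]
    rintro _ ⟨x, y, h, rfl⟩
    exact hK x y h
  refine hle ?_
  rw [mem_closure_isSwap]
  · refine ⟨Set.toFinite _, fun x => ?_⟩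
    obtain ⟨p⟩ := hσ x
    generalize σ x = y at p
    induction p with
    | nil => exact MulAction.mem_orbit_self _
    | @cons a b c hab p ih =>
      have hb : b ∈ MulAction.orbit
          (Subgroup.closure {τ : Perm α | ∃ x y, H.Adj x y ∧ τ = swap x y}) a :=
        ⟨⟨swap a b, Subgroup.subset_closure ⟨a, b, hab, rfl⟩⟩, swap_apply_left a b⟩
      rw [← MulAction.orbit_eq_iff.2 hb]
      exact ih
  · rintro _ ⟨x, y, h, rfl⟩
    exact ⟨x, y, h.ne, rfl⟩

theorem exists_perm_image_eq {α : Type*} [DecidableEq α] [Fintype α] {S A : Finset α}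
    (h : S.card = A.card) : ∃ w : Perm α, S.image w = A := by
  have e : {x // x ∈ S} ≃ {x // x ∈ A} := Fintype.equivOfCardEq (by simpa using h)
  refine ⟨e.extendSubtype, Finset.eq_of_subset_of_card_le ?_ ?_⟩
  · intro y hy
    obtain ⟨x, hx, rfl⟩ := Finset.mem_image.1 hy
    exact e.extendSubtype_mem x hx
  · rw [Finset.card_image_of_injective _ (Equiv.injective _), h]

/-- Start from any permutation taking `S` to `B` and correct the images of `j` and `i` by
transpositions of points outside `B`. -/
theorem exists_perm_image_eq_of_notMem {α : Type*} [DecidableEq α] [Fintype α] {S B : Finset α}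
    (h : S.card = B.card) {i j x y : α} (hi : i ∉ S) (hj : j ∉ S) (hij : i ≠ j) (hx : x ∉ B)
    (hy : y ∉ B) (hxy : x ≠ y) :
    ∃ w : Perm α, S.image w = B ∧ w j = x ∧ w i = y := by
  obtain ⟨w, rfl⟩ := exists_perm_image_eq h
  have hmem : ∀ {k}, k ∈ S → w k ∈ S.image w := fun hk => Finset.mem_image_of_mem w hk
  have hnot : ∀ {k}, k ∉ S → w k ∉ S.image w := by
    intro k hk h'
    obtain ⟨l, hl, e⟩ := Finset.mem_image.1 h'
    exact hk (w.injective e ▸ hl)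
  have himg : ∀ {v : Perm α} {a b : α}, (∀ k ∈ S, v k = w k) → a ∉ S.image w → b ∉ S.image w →
      ∀ k ∈ S, (swap a b * v) k = w k := by
    intro v a b hv ha hb k hk
    rw [Perm.mul_apply, hv k hk, swap_apply_of_ne_of_ne]
    · rintro rfl; exact ha (hmem hk)
    · rintro rfl; exact hb (hmem hk)
  have hv := himg (v := w) (fun _ _ => rfl) (hnot hj) hx
  set v := swap (w j) x * w with hvdef
  have hvj : v j = x := by simp [hvdef]
  have hvi : v i ∉ S.image w := by
    rw [hvdef, Perm.mul_apply]
    by_cases hix : w i = x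
    · rw [hix, swap_apply_right]
      exact hnot hj
    · rw [swap_apply_of_ne_of_ne (fun e => hij (w.injective e)) hix]
      exact hnot hi
  have hu := himg hv hvi hy
  refine ⟨swap (v i) y * v, ?_, ?_, by simp⟩
  · exact Finset.image_congr fun k hk => hu k hk
  · rw [Perm.mul_apply, hvj, swap_apply_of_ne_of_ne _ hxy]
    rw [← hvj]
    exact fun e => hij (v.injective e).symm

/-- A function on the edges of a Johnson graph that sums to zero on triangles is a coboundary. The
value `d B x y` belongs to the edge from `B ∪ {x}` to `B ∪ {y}`. -/
theorem exists_johnson_potential {α : Type*} [DecidableEq α] [Fintype α] (h : ℕ)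
    (d : Finset α → α → α → ℂ)
    (hanti : ∀ B x y, B.card = h → x ∉ B → y ∉ B → x ≠ y → d B x y = - d B y x)
    (hup : ∀ B x y z, B.card = h → x ∉ B → y ∉ B → z ∉ B → x ≠ y → y ≠ z → x ≠ z →
      d B x y + d B y z + d B z x = 0)
    (hdown : ∀ B x y z, B.card + 1 = h → x ∉ B → y ∉ B → z ∉ B → x ≠ y → y ≠ z → x ≠ z →
      d (insert z B) x y + d (insert x B) y z + d (insert y B) z x = 0) :
    ∃ u : Finset α → ℂ, ∀ B x y, B.card = h → x ∉ B → y ∉ B → x ≠ y →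
      d B x y = u (insert x B) - u (insert y B) := by
  -- Build the potential by enlarging the ground set one point at a time.
  suffices H : ∀ T : Finset α, ∃ u : Finset α → ℂ, ∀ B x y, B ⊆ T → x ∈ T → y ∈ T → B.card = h →
      x ∉ B → y ∉ B → x ≠ y → d B x y = u (insert x B) - u (insert y B) by
    obtain ⟨u, hu⟩ := H Finset.univ
    exact ⟨u, fun B x y => hu B x y (Finset.subset_univ _) (Finset.mem_univ _) (Finset.mem_univ _)⟩
  intro T
  induction T using Finset.induction_on with
  | empty => exact ⟨0, fun B x y _ hx => absurd hx (Finset.notMem_empty _)⟩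
  | insert z T hz ih =>
    obtain ⟨u₀, hu₀⟩ := ih
    classical
    -- On a set `B ∪ {z}` the value is forced by any edge to some `B ∪ {y}` with `y ∈ T`. If no such
    -- `y` exists the value is arbitrary, and is taken to be `0`.
    have hex : ∃ u : Finset α → ℂ, (∀ C, z ∉ C → u C = u₀ C) ∧
        ∀ B y, B ⊆ T → B.card = h → y ∈ T → y ∉ B →
          u (insert z B) = u₀ (insert y B) + d B z y := by
      refine ⟨fun C => if z ∈ C then
        (if hy : ∃ y, y ∈ T ∧ y ∉ C.erase z then
          u₀ (insert hy.choose (C.erase z)) + d (C.erase z) z hy.choose else 0) else u₀ C, ?_, ?_⟩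
      · intro C hC
        exact if_neg hC
      · intro B y hB hBc hy hyB
        have hzB : z ∉ B := fun h' => hz (hB h')
        have he : (insert z B).erase z = B := Finset.erase_insert hzB
        have hy' : ∃ y, y ∈ T ∧ y ∉ (insert z B).erase z := ⟨y, hy, by rwa [he]⟩
        simp only [Finset.mem_insert_self, if_true, dif_pos hy']
        have hc := hy'.choose_spec
        generalize hy'.choose = c at hc
        rw [he] at hc ⊢
        -- Independence of the chosen neighbour is the triangle `B ∪ {z}, B ∪ {c}, B ∪ {y}`, that is
        -- `hup`.
        by_cases hcy : c = y
        · rw [hcy]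
        · have h1 := hu₀ B c y hB hc.1 hy hBc hc.2 hyB hcy
          have hzc : z ≠ c := by rintro rfl; exact hz hc.1
          have hzy : z ≠ y := by rintro rfl; exact hz hy
          have h2 := hup B z c y hBc hzB hc.2 hyB hzc hcy hzy
          have h3 := hanti B y z hBc hyB hzB hzy.symm
          linear_combination h2 - h1 - h3
    obtain ⟨u, hu1, hu2⟩ := hex
    refine ⟨u, fun B x y hB hx hy hBc hxB hyB hxy => ?_⟩
    -- Here both end sets contain `z`. Exchanging `z` for `y` in one and for `x` in the other leads
    -- to the same set `B' ∪ {x, y}`, so the values of `u₀` cancel and `hdown` remains.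
    by_cases hzB : z ∈ B
    · have hxz : x ≠ z := by rintro rfl; exact hxB hzB
      have hyz : y ≠ z := by rintro rfl; exact hyB hzB
      have hxT : x ∈ T := (Finset.mem_insert.1 hx).resolve_left hxz
      have hyT : y ∈ T := (Finset.mem_insert.1 hy).resolve_left hyz
      obtain ⟨B', hzB', rfl⟩ : ∃ B', z ∉ B' ∧ B = insert z B' :=
        ⟨B.erase z, Finset.notMem_erase _ _, (Finset.insert_erase hzB).symm⟩
      have hB' : B' ⊆ T := fun t ht =>
        (Finset.mem_insert.1 (hB (Finset.mem_insert_of_mem ht))).resolve_left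
          (by rintro rfl; exact hzB' ht)
      rw [Finset.card_insert_of_notMem hzB'] at hBc
      have hxB' : x ∉ B' := fun h' => hxB (Finset.mem_insert_of_mem h')
      have hyB' : y ∉ B' := fun h' => hyB (Finset.mem_insert_of_mem h')
      have h1 := hu2 (insert x B') y (Finset.insert_subset hxT hB')
        (by rw [Finset.card_insert_of_notMem hxB', hBc]) hyT (by simp [hxy.symm, hyB'])
      have h2 := hu2 (insert y B') x (Finset.insert_subset hyT hB')
        (by rw [Finset.card_insert_of_notMem hyB', hBc]) hxT (by simp [hxy, hxB'])
      have h3 := hdown B' x y z hBc hxB' hyB' hzB' hxy hyz hxz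
      have h4 := hanti (insert x B') y z (by rw [Finset.card_insert_of_notMem hxB', hBc])
        (by simp [hxy.symm, hyB']) (by simp [hxz.symm, hzB']) hyz
      rw [Finset.insert_comm x z, Finset.insert_comm y z, h1, h2, Finset.insert_comm y x]
      linear_combination h3 - h4
    · have hBT : B ⊆ T := fun t ht =>
        (Finset.mem_insert.1 (hB ht)).resolve_left (by rintro rfl; exact hzB ht)
      by_cases hxz : x = z
      · subst hxz
        have hyT : y ∈ T := (Finset.mem_insert.1 hy).resolve_left hxy.symm
        rw [hu2 B y hBT hBc hyT hyB, hu1 (insert y B) (by simp [hxy, hzB])]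
        ring
      by_cases hyz : y = z
      · subst hyz
        have hxT : x ∈ T := (Finset.mem_insert.1 hx).resolve_left hxy
        rw [hu2 B x hBT hBc hxT hxB, hu1 (insert x B) (by simp [Ne.symm hxy, hzB]),
          hanti B x y hBc hxB hyB hxy]
        ring
      · have hxT : x ∈ T := (Finset.mem_insert.1 hx).resolve_left hxz
        have hyT : y ∈ T := (Finset.mem_insert.1 hy).resolve_left hyz
        rw [hu1 _ (by simp [Ne.symm hxz, hzB]), hu1 _ (by simp [Ne.symm hyz, hzB])]
        exact hu₀ B x y hBT hxT hyT hBc hxB hyB hxy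

variable {n : ℕ}

/-- The permutations of the positions that fix `f`. -/
def invariants (f : Perm (Fin n) → ℂ) : Subgroup (Perm (Fin n)) where
  carrier := {σ | ∀ w, f (w * σ) = f w}
  mul_mem' := by
    intro σ τ hσ hτ w
    rw [← mul_assoc, hτ, hσ]
  one_mem' := by
    intro w
    rw [mul_one]
  inv_mem' := by
    intro σ hσ w
    rw [← hσ (w * σ⁻¹), inv_mul_cancel_right]

theorem mem_invariants {f : Perm (Fin n) → ℂ} {σ : Perm (Fin n)} :
    σ ∈ invariants f ↔ ∀ w, f (w * σ) = f w := Iff.rfl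

theorem image_mul_swap {S : Finset (Fin n)} {i j : Fin n} (hj : j ∈ S) (hi : i ∉ S)
    (w : Perm (Fin n)) :
    S.image (w * swap i j : Perm (Fin n)) = insert (w i) ((S.erase j).image w) := by
  conv_lhs => rw [← Finset.insert_erase hj]
  rw [Finset.image_insert, Perm.mul_apply, swap_apply_right]
  congr 1
  refine Finset.image_congr fun k hk => ?_
  have hk' := Finset.mem_erase.1 hk
  rw [Perm.mul_apply, swap_apply_of_ne_of_ne _ hk'.1]
  rintro rfl
  exact hi hk'.2

/-- By invariance `D w` depends only on `w(S \ {j})`, `w j` and `w i`. It is thus a function on the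
edges of the Johnson graph of `|S|`-subsets, and antisymmetry and the triangle relation make it a
coboundary. -/
theorem exists_potential {S : Finset (Fin n)} {i j : Fin n} (hj : j ∈ S) (hi : i ∉ S)
    {D : Perm (Fin n) → ℂ} (hanti : ∀ w, D (w * swap i j) = - D w)
    (hinv : ∀ x y, x ≠ i → x ≠ j → y ≠ i → y ≠ j → (x ∈ S ↔ y ∈ S) → swap x y ∈ invariants D)
    (htri : ∀ k, k ≠ i → k ≠ j → ∀ w, D w + D (w * (swap i j * swap j k)) +
      D (w * (swap j k * swap i j)) = 0) :
    ∃ u : Finset (Fin n) → ℂ, ∀ w,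
      D w = u (S.image w) - u (S.image (w * swap i j : Perm (Fin n))) := by
  have hij : i ≠ j := by rintro rfl; exact hi hj
  have hiS : i ∉ S.erase j := fun h => hi (Finset.mem_of_mem_erase h)
  have hjS : j ∉ S.erase j := Finset.notMem_erase _ _
  have hwd : ∀ w w' : Perm (Fin n), (S.erase j).image w = (S.erase j).image w' → w j = w' j →
      w i = w' i → D w = D w' := by
    intro w w' h1 h2 h3
    have hσ : w⁻¹ * w' ∈ invariants D := by
      have hσi : (w⁻¹ * w') i = i := by rw [Perm.mul_apply, ← h3]; simp
      have hσj : (w⁻¹ * w') j = j := by rw [Perm.mul_apply, ← h2]; simp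
      have hσS : ∀ x, x ∈ S.erase j ↔ (w⁻¹ * w') x ∈ S.erase j := by
        intro x
        rw [← w'.injective.mem_finset_image, ← w.injective.mem_finset_image (a := (w⁻¹ * w') x),
          h1, Perm.mul_apply]
        simp
      let H : SimpleGraph (Fin n) :=
        { Adj := fun x y => x ≠ y ∧ x ≠ i ∧ x ≠ j ∧ y ≠ i ∧ y ≠ j ∧ (x ∈ S ↔ y ∈ S)
          symm := ⟨fun x y h => ⟨h.1.symm, h.2.2.2.1, h.2.2.2.2.1, h.2.1, h.2.2.1,
            h.2.2.2.2.2.symm⟩⟩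
          loopless := ⟨fun x h => h.1 rfl⟩ }
      refine mem_subgroup_of_forall_reachable _ H
        (fun x y h => hinv x y h.2.1 h.2.2.1 h.2.2.2.1 h.2.2.2.2.1 h.2.2.2.2.2) fun x => ?_
      by_cases hxi : x = i
      · rw [hxi, hσi]
      by_cases hxj : x = j
      · rw [hxj, hσj]
      by_cases hx : x = (w⁻¹ * w') x
      · rw [← hx]
      refine Adj.reachable (G := H) ⟨hx, hxi, hxj, ?_, ?_, ?_⟩
      · exact fun e => hxi ((w⁻¹ * w').injective (e.trans hσi.symm))
      · exact fun e => hxj ((w⁻¹ * w').injective (e.trans hσj.symm))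
      · have := hσS x
        rw [Finset.mem_erase, Finset.mem_erase] at this
        have h4 : (w⁻¹ * w') x ≠ j := fun e => hxj ((w⁻¹ * w').injective (e.trans hσj.symm))
        exact ⟨fun hx => (this.1 ⟨hxj, hx⟩).2, fun hx => (this.2 ⟨h4, hx⟩).2⟩
    have := hσ w
    rw [mul_inv_cancel_left] at this
    exact this.symm
  classical
  -- Descend `D` to triples; the default `0` is only taken at triples that no permutation realises.
  let d : Finset (Fin n) → Fin n → Fin n → ℂ := fun B x y =>
    if h : ∃ w : Perm (Fin n), (S.erase j).image w = B ∧ w j = x ∧ w i = y then D h.choose else 0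
  have hd : ∀ w : Perm (Fin n), d ((S.erase j).image w) (w j) (w i) = D w := by
    intro w
    have hex : ∃ w' : Perm (Fin n),
        (S.erase j).image w' = (S.erase j).image w ∧ w' j = w j ∧ w' i = w i := ⟨w, rfl, rfl, rfl⟩
    have := hex.choose_spec
    simp only [d, dif_pos hex]
    exact hwd _ _ this.1 this.2.1 this.2.2
  have hd' : ∀ {w : Perm (Fin n)} {B x y}, (S.erase j).image w = B → w j = x → w i = y →
      d B x y = D w := by
    rintro w _ _ _ rfl rfl rfl
    exact hd w
  have himg : ∀ {w : Perm (Fin n)} {τ : Perm (Fin n)}, (∀ k ∈ S.erase j, τ k = k) →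
      (S.erase j).image (w * τ : Perm (Fin n)) = (S.erase j).image w := by
    intro w τ hτ
    refine Finset.image_congr fun k hk => ?_
    rw [Perm.mul_apply, hτ k hk]
  obtain ⟨u, hu⟩ : ∃ u : Finset (Fin n) → ℂ, ∀ B x y, B.card = (S.erase j).card → x ∉ B → y ∉ B →
      x ≠ y → d B x y = u (insert x B) - u (insert y B) := by
    apply exists_johnson_potential
    · intro B x y hB hx hy hxy
      obtain ⟨w, h1, h2, h3⟩ := exists_perm_image_eq_of_notMem hB.symm hiS hjS hij hx hy hxy
      rw [hd' h1 h2 h3, ← neg_eq_iff_eq_neg, ← hanti]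
      refine (hd' ?_ ?_ ?_).symm
      · rw [himg, h1]
        intro k hk
        exact swap_apply_of_ne_of_ne (by rintro rfl; exact hiS hk) (by rintro rfl; exact hjS hk)
      · simp [h3]
      · simp [h2]
    · intro B x y z hB hx hy hz hxy hyz hxz
      obtain ⟨w, h1, h2, h3⟩ := exists_perm_image_eq_of_notMem hB.symm hiS hjS hij hx hy hxy
      obtain ⟨k, rfl⟩ := w.surjective z
      have hki : k ≠ i := by rintro rfl; exact hyz h3.symm
      have hkj : k ≠ j := by rintro rfl; exact hxz h2.symm
      have hkS : k ∉ S.erase j := fun h => hz (h1 ▸ Finset.mem_image_of_mem w h)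
      have ht := htri k hki hkj w
      have hfix : ∀ l ∈ S.erase j, swap i j l = l ∧ swap j k l = l := by
        intro l hl
        have e1 : l ≠ i := by rintro rfl; exact hiS hl
        have e2 : l ≠ j := by rintro rfl; exact hjS hl
        have e3 : l ≠ k := by rintro rfl; exact hkS hl
        exact ⟨swap_apply_of_ne_of_ne e1 e2, swap_apply_of_ne_of_ne e2 e3⟩
      -- The two 3-cycles in `htri` rotate the values at `i, j, k`. As `k ∉ S`, the set `B` stays
      -- fixed and the three terms are the edges of the triangle `B ∪ {x}, B ∪ {y}, B ∪ {z}`.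
      rw [hd' h1 h2 h3, hd' (w := w * (swap j k * swap i j)) (B := B) (x := y) (y := w k),
        hd' (w := w * (swap i j * swap j k)) (B := B) (x := w k) (y := x)]
      · linear_combination ht
      · rw [himg, h1]
        intro l hl
        rw [Perm.mul_apply, (hfix l hl).2, (hfix l hl).1]
      · simp [swap_apply_of_ne_of_ne hki hkj]
      · simp [swap_apply_of_ne_of_ne hij hki.symm, h2]
      · rw [himg, h1]
        intro l hl
        rw [Perm.mul_apply, (hfix l hl).1, (hfix l hl).2]
      · simp [swap_apply_of_ne_of_ne hij hki.symm, h3]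
      · simp
    · intro B x y z hB hx hy hz hxy hyz hxz
      obtain ⟨w, h1, h2, h3⟩ := exists_perm_image_eq_of_notMem (S := S.erase j) (B := insert z B)
        (by rw [Finset.card_insert_of_notMem hz, hB]) hiS hjS hij (x := x) (y := y)
        (by simp [hxz, hx]) (by simp [hyz, hy]) hxy
      obtain ⟨k, rfl⟩ := w.surjective z
      have hki : k ≠ i := by rintro rfl; exact hyz h3.symm
      have hkj : k ≠ j := by rintro rfl; exact hxz h2.symm
      have hkS : k ∈ S.erase j := by
        rw [← w.injective.mem_finset_image, h1]
        exact Finset.mem_insert_self _ _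
      have ht := htri k hki hkj w
      have hB' : ((S.erase j).erase k).image w = B := by
        rw [Finset.image_erase w.injective, h1, Finset.erase_insert hz]
      have hfix : ∀ l ∈ (S.erase j).erase k, swap i j l = l ∧ swap j k l = l := by
        intro l hl
        have hl' := Finset.mem_erase.1 hl
        have e1 : l ≠ i := by rintro rfl; exact hiS hl'.2
        have e2 : l ≠ j := by rintro rfl; exact hjS hl'.2
        exact ⟨swap_apply_of_ne_of_ne e1 e2, swap_apply_of_ne_of_ne e2 hl'.1⟩
      have himg' : ∀ {τ : Perm (Fin n)}, (∀ l ∈ (S.erase j).erase k, τ l = l) →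
          (S.erase j).image (w * τ : Perm (Fin n)) = insert (w (τ k)) B := by
        intro τ hτ
        conv_lhs => rw [← Finset.insert_erase hkS]
        rw [Finset.image_insert, Perm.mul_apply, ← hB']
        congr 1
        refine Finset.image_congr fun l hl => ?_
        rw [Perm.mul_apply, hτ l hl]
      -- Now `k ∈ S`, so the rotation also changes the common set. The triangle is the other kind,
      -- formed by `B` with two of the three points `x, y, z`.
      rw [hd' h1 h2 h3, hd' (w := w * (swap j k * swap i j)) (B := insert x B) (x := y) (y := w k),
        hd' (w := w * (swap i j * swap j k)) (B := insert y B) (x := w k) (y := x)]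
      · linear_combination ht
      · rw [himg', Perm.mul_apply, swap_apply_right, swap_apply_right, h3]
        intro l hl
        rw [Perm.mul_apply, (hfix l hl).2, (hfix l hl).1]
      · simp [swap_apply_of_ne_of_ne hki hkj]
      · simp [swap_apply_of_ne_of_ne hij hki.symm, h2]
      · rw [himg', Perm.mul_apply, swap_apply_of_ne_of_ne hki hkj, swap_apply_right, h2]
        intro l hl
        rw [Perm.mul_apply, (hfix l hl).1, (hfix l hl).2]
      · simp [swap_apply_of_ne_of_ne hij hki.symm, h3]
      · simp
  refine ⟨u, fun w => ?_⟩
  have hnot : ∀ {k}, k ∉ S.erase j → w k ∉ (S.erase j).image w := fun hk h =>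
    hk ((w.injective.mem_finset_image).1 h)
  rw [← hd w, hu _ _ _ (Finset.card_image_of_injective _ w.injective) (hnot hjS) (hnot hiS)
    (fun e => hij (w.injective e).symm), image_mul_swap hj hi, ← Finset.image_insert,
    Finset.insert_erase hj]

end Invariance

/-! ### Jumps of a linear spline across the edges -/

section Jumps

open Equiv

variable {n : ℕ} {Γ : SimpleGraph (Fin n)} {a : Fin n → Perm (Fin n) → ℂ}

/-- The change of the coordinate `a j` when the values in positions `i` and `j` are exchanged. -/
def jump (i j : Fin n) : (Fin n → Perm (Fin n) → ℂ) →ₗ[ℂ] (Perm (Fin n) → ℂ) where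
  toFun a := fun w => a j w - a j (w * swap i j)
  map_add' a b := by
    funext w
    simp only [Pi.add_apply]
    ring
  map_smul' c a := by
    funext w
    simp only [Pi.smul_apply, smul_eq_mul, RingHom.id_apply]
    ring

theorem jump_apply (i j : Fin n) (w : Perm (Fin n)) :
    jump i j a w = a j w - a j (w * swap i j) := rfl

/-- Every edge avoiding `p` preserves `a p`, so all permutations inside a component of `Γ - p` do.
-/
theorem swap_mem_invariants_of_reachable (ha : a ∈ coordSplines Γ) {p x y : Fin n}
    (h : (isolate Γ p).Reachable x y) : swap x y ∈ invariants (a p) := by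
  refine mem_subgroup_of_forall_reachable (invariants (a p)) (isolate Γ p)
    (fun x y hxy w => (ha x y hxy.1 w).1 p hxy.2.1.symm hxy.2.2.symm) fun z => ?_
  by_cases hx : z = x
  · rw [hx, swap_apply_left]
    exact h
  by_cases hy : z = y
  · rw [hy, swap_apply_right]
    exact h.symm
  · rw [swap_apply_of_ne_of_ne hx hy]

theorem jump_eq (ha : a ∈ coordSplines Γ) {i j : Fin n} (hij : Γ.Adj i j) (w : Perm (Fin n)) :
    jump i j a w = a i (w * swap i j) - a i w := by
  rw [jump_apply]
  linear_combination -(ha i j hij w).2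

theorem jump_mul_swap (i j : Fin n) (w : Perm (Fin n)) :
    jump i j a (w * swap i j) = - jump i j a w := by
  rw [jump_apply, jump_apply, mul_assoc, swap_mul_self, mul_one]
  ring

theorem swap_mul_comm_of_ne {i j x y : Fin n} (hxi : x ≠ i) (hxj : x ≠ j) (hyi : y ≠ i)
    (hyj : y ≠ j) : swap x y * swap i j = swap i j * swap x y := by
  rw [mul_swap_eq_swap_mul, swap_apply_of_ne_of_ne hxi.symm hyi.symm,
    swap_apply_of_ne_of_ne hxj.symm hyj.symm]

/-- The jump can be read from `a i` as well as from `a j`, so it inherits the invariance of either;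
a transposition away from `i` and `j` commutes with `(i, j)`. -/
theorem swap_mem_invariants_jump (ha : a ∈ coordSplines Γ) {i j x y : Fin n} (hij : Γ.Adj i j)
    (hxi : x ≠ i) (hxj : x ≠ j) (hyi : y ≠ i) (hyj : y ≠ j)
    (h : (isolate Γ i).Reachable x y ∨ (isolate Γ j).Reachable x y) :
    swap x y ∈ invariants (jump i j a) := by
  intro w
  have hc := swap_mul_comm_of_ne hxi hxj hyi hyj
  rcases h with h | h
  · have h1 := swap_mem_invariants_of_reachable ha h
    rw [jump_eq ha hij, jump_eq ha hij, mul_assoc, hc, ← mul_assoc, h1, h1]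
  · have h1 := swap_mem_invariants_of_reachable ha h
    rw [jump_apply, jump_apply, mul_assoc, hc, ← mul_assoc, h1, h1]

/-- By `reachable_isolate_or`, either `a i` is invariant under `(j, k)` or `a j` is invariant under
`(i, k)`. Writing the three jumps through that coordinate makes the sum telescope. -/
theorem jump_triangle (hΓ : Γ.Connected) (ha : a ∈ coordSplines Γ) {i j k : Fin n}
    (hij : Γ.Adj i j) (hki : k ≠ i) (hkj : k ≠ j) (w : Perm (Fin n)) :
    jump i j a w + jump i j a (w * (swap i j * swap j k)) +
      jump i j a (w * (swap j k * swap i j)) = 0 := by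
  have e1 : swap i j * swap j k * swap i j = swap i k := by
    have := swap_mul_swap_mul_swap hkj hki
    rwa [swap_comm j i, swap_comm k j] at this
  have e2 : swap j k * swap i j * swap j k = swap i k := by
    rw [swap_mul_swap_mul_swap hij.ne hki.symm, swap_comm]
  have e3 : w * (swap j k * swap i j) * swap i j = w * swap j k := by
    rw [mul_assoc, mul_assoc, swap_mul_self, mul_one]
  rcases reachable_isolate_or hΓ hij.ne k with h | h
  · have h1 := swap_mem_invariants_of_reachable ha h
    rw [swap_comm, mem_invariants] at h1
    have e4 : w * (swap i j * swap j k) * swap i j = w * (swap j k * swap i j) * swap j k := by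
      rw [mul_assoc, e1, ← e2, ← mul_assoc]
    rw [jump_eq ha hij, jump_eq ha hij, jump_eq ha hij, e3, e4, ← mul_assoc w (swap i j) (swap j k),
      h1, h1, h1]
    ring
  · have h1 := swap_mem_invariants_of_reachable ha h
    rw [swap_comm, mem_invariants] at h1
    have e4 : w * (swap i j * swap j k) * swap i j = w * swap i k := by rw [mul_assoc, e1]
    have e5 : w * (swap j k * swap i j) = w * swap i j * swap i k := by
      rw [← e1, ← mul_assoc, ← mul_assoc, ← mul_assoc, mul_assoc w (swap i j) (swap i j),
        swap_mul_self, mul_one, mul_assoc]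
    have e6 : w * (swap i j * swap j k) = w * swap j k * swap i k := by
      rw [← e2, ← mul_assoc, ← mul_assoc, ← mul_assoc, mul_assoc w (swap j k) (swap j k),
        swap_mul_self, mul_one]
    rw [jump_apply, jump_apply, jump_apply, e3, e4, e5, e6, h1, h1, h1]
    ring

theorem swap_mem_invariants_iff_jump {i j : Fin n} :
    swap i j ∈ invariants (a j) ↔ jump i j a = 0 := by
  rw [mem_invariants, funext_iff]
  refine forall_congr' fun w => ?_
  rw [jump_apply, Pi.zero_apply, sub_eq_zero, eq_comm]

theorem swap_mem_invariants_iff (ha : a ∈ coordSplines Γ) {i j : Fin n} (hij : Γ.Adj i j) :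
    swap i j ∈ invariants (a i) ↔ swap i j ∈ invariants (a j) := by
  rw [mem_invariants, mem_invariants]
  refine forall_congr' fun w => ?_
  have := (ha i j hij w).2
  constructor <;> intro h <;> linear_combination this - h

/-- Conjugate `(p, q)` by `(q, q')`, which already preserves `a p`. One edge into a component
therefore decides all the others. -/
theorem swap_mem_invariants_trans (ha : a ∈ coordSplines Γ) {p q q' : Fin n} (hq : q ≠ p)
    (hq' : q' ≠ p) (h : (isolate Γ p).Reachable q q') (hs : swap p q ∈ invariants (a p)) :
    swap p q' ∈ invariants (a p) := by
  rcases eq_or_ne q q' with rfl | hne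
  · exact hs
  have h1 := swap_mem_invariants_of_reachable ha h
  rw [swap_comm p q', ← swap_mul_swap_mul_swap hq.symm hq'.symm]
  exact mul_mem (mul_mem h1 hs) h1

/-- If no jump occurs on the edges to components away from a root `r`, then all coordinates are
constant. -/
theorem eq_const_of_jump_eq_zero (hΓ : Γ.Connected) (ha : a ∈ coordSplines Γ) (r : Fin n)
    (h : ∀ i G, IsComponentOfDelete Γ i G → r ∉ G → ∃ j ∈ G, Γ.Adj i j ∧ jump i j a = 0)
    (p : Fin n) (w : Perm (Fin n)) : a p w = a p 1 := by
  -- Induction on the distance to the root. An edge from `p` into a component away from `r` is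
  -- covered by the hypothesis. For the component containing `r`, the edge to a neighbour closer to
  -- `r` has already been treated from its other end.
  have key : ∀ (d : ℕ) (p : Fin n), Γ.dist p r = d → ∀ q, Γ.Adj p q →
      swap p q ∈ invariants (a p) := by
    intro d
    induction d using Nat.strong_induction_on with
    | _ d ih =>
      intro p hp q hpq
      have hG := isComponentOfDelete_setOf (Γ := Γ) hpq.ne'
      set G := {y | (isolate Γ p).Reachable q y} with hGdef
      by_cases hr : r ∈ G
      · have hpr : p ≠ r := fun e => hG.notMem (e ▸ hr)
        obtain ⟨W, hW⟩ := hΓ.exists_walk_length_eq_dist p r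
        cases W with
        | nil => exact absurd rfl hpr
        | @cons _ p' _ hpp' W =>
          rw [Walk.length_cons] at hW
          have hlt : Γ.dist p' r < Γ.dist p r := by
            have := dist_le W
            omega
          have h1 := ih _ (hp ▸ hlt) p' rfl p hpp'.symm
          rw [swap_mem_invariants_iff ha hpp'.symm, swap_comm] at h1
          refine swap_mem_invariants_trans ha hpp'.ne' hpq.ne' ?_ h1
          have hp'r : (isolate Γ p).Reachable p' r := by
            by_contra hc
            exact absurd (dist_lt_of_not_reachable_isolate hΓ hpp'.ne' hc) (by omega)
          exact hp'r.trans (Reachable.symm hr)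
      · obtain ⟨j, hj, hpj, hz⟩ := h p G hG hr
        refine swap_mem_invariants_trans ha hpj.ne' hpq.ne' (Reachable.symm hj) ?_
        rw [swap_mem_invariants_iff ha hpj]
        exact swap_mem_invariants_iff_jump.2 hz
  -- Every edge now preserves `a p`, and the edges of a connected graph generate the symmetric
  -- group.
  have hw : w ∈ invariants (a p) := by
    refine mem_subgroup_of_forall_reachable _ Γ (fun x y hxy => ?_)
      (fun x => hΓ.preconnected _ _)
    rcases eq_or_ne p x with rfl | hpx
    · exact key _ p rfl y hxy
    rcases eq_or_ne p y with rfl | hpy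
    · rw [swap_comm]
      exact key _ p rfl x hxy.symm
    · exact fun w => (ha x y hxy w).1 p hpx hpy
  have := hw 1
  rwa [one_mul] at this

end Jumps

/-! ### A basis of the linear splines -/

section Basis

open Equiv MvPolynomial

variable {n : ℕ} {Γ : SimpleGraph (Fin n)}

open Classical in
/-- A neighbour of `i` in the component `G` of `Γ - i`. -/
def attach (Γ : SimpleGraph (Fin n)) (i : Fin n) (G : Set (Fin n)) : Fin n :=
  if h : ∃ j ∈ G, Γ.Adj i j then h.choose else i

open Classical in
/-- The component `G` itself if it is attached to `i` by a cut edge, and a neighbour of `i`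
in `G` otherwise. -/
def marked (Γ : SimpleGraph (Fin n)) (i : Fin n) (G : Set (Fin n)) : Finset (Fin n) :=
  if IsCutEdge Γ i (attach Γ i G) then Finset.univ.filter (· ∈ G) else {attach Γ i G}

theorem IsComponentOfDelete.attach_spec {i : Fin n} {G : Set (Fin n)} (hΓ : Γ.Connected)
    (h : IsComponentOfDelete Γ i G) : attach Γ i G ∈ G ∧ Γ.Adj i (attach Γ i G) := by
  have := h.exists_adj hΓ
  unfold attach
  rw [dif_pos this]
  exact this.choose_spec

theorem attach_mem_marked {i : Fin n} {G : Set (Fin n)} (hΓ : Γ.Connected)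
    (h : IsComponentOfDelete Γ i G) : attach Γ i G ∈ marked Γ i G := by
  unfold marked
  split_ifs
  · simpa using (h.attach_spec hΓ).1
  · simp

theorem notMem_marked {i : Fin n} {G : Set (Fin n)} (hΓ : Γ.Connected)
    (h : IsComponentOfDelete Γ i G) : i ∉ marked Γ i G := by
  unfold marked
  split_ifs
  · simpa using h.notMem
  · simpa using (h.attach_spec hΓ).2.ne

/-- Inside `G` the jump has the symmetry of `a i`, and outside `G` that of `a j`. If the edge is not
a cut edge, the two symmetry groups merge, which is why a one-point marked set then suffices. -/
theorem exists_jump_potential {i : Fin n} {G : Set (Fin n)} (hΓ : Γ.Connected)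
    (h : IsComponentOfDelete Γ i G) {a : Fin n → Perm (Fin n) → ℂ} (ha : a ∈ coordSplines Γ) :
    ∃ u : Finset (Fin n) → ℂ, ∀ w, jump i (attach Γ i G) a w =
      u ((marked Γ i G).image w) -
        u ((marked Γ i G).image (w * swap i (attach Γ i G) : Perm (Fin n))) := by
  obtain ⟨hj, hij⟩ := h.attach_spec hΓ
  refine exists_potential (attach_mem_marked hΓ h) (notMem_marked hΓ h) (jump_mul_swap _ _) ?_
    (fun k hki hkj w => jump_triangle hΓ ha hij hki hkj w)
  have hside : ∀ x, x ∉ G → (isolate Γ (attach Γ i G)).Reachable x i := fun x hx =>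
    (reachable_isolate_or hΓ hij.ne x).resolve_left
      fun h' => hx ((h.mem_iff hj).2 h'.symm)
  have hsame : ∀ x y, x ≠ i → x ≠ attach Γ i G → y ≠ i → y ≠ attach Γ i G → (x ∈ G ↔ y ∈ G) →
      swap x y ∈ invariants (jump i (attach Γ i G) a) := by
    intro x y hxi hxj hyi hyj hxy
    refine swap_mem_invariants_jump ha hij hxi hxj hyi hyj ?_
    by_cases hx : x ∈ G
    · exact Or.inl ((h.mem_iff hx).1 (hxy.1 hx))
    · exact Or.inr ((hside x hx).trans (hside y fun hy => hx (hxy.2 hy)).symm)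
  intro x y hxi hxj hyi hyj hxy
  by_cases hc : IsCutEdge Γ i (attach Γ i G)
  · unfold marked at hxy
    rw [if_pos hc] at hxy
    exact hsame x y hxi hxj hyi hyj (by simpa using hxy)
  · rw [isCutEdge_iff hΓ hij, not_not] at hc
    -- A second neighbour `k` of `i` in `G` is linked to `G` avoiding `i`, and through `i` to the
    -- complement of `G` avoiding `j`. So every `(x, k)` with `x ≠ i, j` preserves the jump, and
    -- these transpositions generate all the others.
    obtain ⟨k, hkj, hik, hk⟩ := exists_adj_of_reachable_deleteEdges hij.ne hc
    have hkG : k ∈ G := (h.mem_iff hj).2 hk.symm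
    have hki : (isolate Γ (attach Γ i G)).Reachable k i :=
      Adj.reachable (G := isolate Γ (attach Γ i G)) ⟨hik.symm, hkj, hij.ne⟩
    have hto : ∀ x, x ≠ i → x ≠ attach Γ i G →
        swap x k ∈ invariants (jump i (attach Γ i G) a) := by
      intro x hxi hxj
      refine swap_mem_invariants_jump ha hij hxi hxj hik.ne' hkj ?_
      by_cases hx : x ∈ G
      · exact Or.inl ((h.mem_iff hx).1 hkG)
      · exact Or.inr ((hside x hx).trans hki.symm)
    rcases eq_or_ne x k with rfl | hxk
    · rw [swap_comm]
      exact hto y hyi hyj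
    rcases eq_or_ne y k with rfl | hyk
    · exact hto x hxi hxj
    rcases eq_or_ne x y with rfl | hxy'
    · rw [swap_self]
      exact one_mem _
    · rw [swap_comm x y, ← swap_mul_swap_mul_swap hxk hxy', swap_comm k y]
      exact mul_mem (mul_mem (hto y hyi hyj) (hto x hxi hxj)) (hto y hyi hyj)

end Basis

/-! ### The splines attached to pendant components, and their jumps -/

section Generators

open Equiv MvPolynomial

variable {n : ℕ} {Γ : SimpleGraph (Fin n)}

open Classical in
/-- The coordinates of the spline attached to a component `G` of `Γ - i` and a set `A`: a linear
coset spline if `G` is attached to `i` by a cut edge, and the spline `ȳ^i_{G,k}` with `A = {k}`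
otherwise. -/
def pendantSpline (Γ : SimpleGraph (Fin n)) (i : Fin n) (G : Set (Fin n)) (A : Finset (Fin n)) :
    Fin n → Perm (Fin n) → ℂ := fun p w =>
  if IsCutEdge Γ i (attach Γ i G) then
    if (marked Γ i G).image w = A then (if p = attach Γ i G then 1 else if p = i then -1 else 0)
    else 0
  else
    if p = i then (if ∃ q ∈ G, A = {w q} then -1 else 0)
    else if p ∈ G ∧ A = {w p} then 1 else 0

theorem preimage_eq_iff_image_eq {G : Set (Fin n)} {S A : Finset (Fin n)} (hS : (S : Set _) = G)
    (w : Perm (Fin n)) : w ⁻¹' (A : Set (Fin n)) = G ↔ S.image w = A := by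
  rw [← Finset.coe_inj, Finset.coe_image, hS]
  constructor
  · rintro rfl
    exact Set.image_preimage_eq _ w.surjective
  · intro h
    rw [← h, Set.preimage_image_eq _ w.injective]

theorem coe_marked_of_isCutEdge {i : Fin n} {G : Set (Fin n)}
    (hc : IsCutEdge Γ i (attach Γ i G)) : (marked Γ i G : Set (Fin n)) = G := by
  unfold marked
  rw [if_pos hc]
  ext
  simp

theorem card_marked_of_isCutEdge {i : Fin n} {G : Set (Fin n)}
    (hc : IsCutEdge Γ i (attach Γ i G)) : (marked Γ i G).card = G.ncard := by
  rw [← Set.ncard_coe_finset, coe_marked_of_isCutEdge hc]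

theorem marked_of_not_isCutEdge {i : Fin n} {G : Set (Fin n)}
    (hc : ¬ IsCutEdge Γ i (attach Γ i G)) : marked Γ i G = {attach Γ i G} := by
  unfold marked
  rw [if_neg hc]

/-- If `i` is not a cut vertex, then `G` is everything except `i` and `ȳ^i_{G,k} = t̄_k - x̄_i`.
This removes the restriction to cut vertices. -/
theorem yBar_mem_span_linearGenerators {i : Fin n} {G : Set (Fin n)}
    (h : IsComponentOfDelete Γ i G) (k : Fin n) :
    yBar i G k ∈ Submodule.span ℂ (linearGenerators Γ) := by
  by_cases hi : IsCutVertex Γ i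
  · exact Submodule.subset_span (Or.inr ⟨i, G, k, hi, h, rfl⟩)
  · have h1 : yBar i G k = tBar k - xBar i := by
      funext w
      rw [Pi.sub_apply]
      unfold yBar tBar xBar
      split_ifs with hk
      · rfl
      · have : w⁻¹ k = i := by
          by_contra hne
          obtain ⟨x, hx⟩ := h.nonempty
          refine hi (isCutVertex_iff.2 ⟨x, w⁻¹ k, fun e => h.notMem (e ▸ hx), hne, ?_⟩)
          exact fun h' => hk ((h.mem_iff hx).2 h')
        have : k = w i := by rw [← this]; simp
        rw [this, sub_self]
    rw [h1]
    exact sub_mem (Submodule.subset_span (Or.inl (Or.inl (Or.inl ⟨k, rfl⟩))))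
      (Submodule.subset_span (Or.inl (Or.inl (Or.inr ⟨i, rfl⟩))))

theorem ofCoords_pendantSpline_of_isCutEdge {i : Fin n} {G : Set (Fin n)} (hΓ : Γ.Connected)
    (h : IsComponentOfDelete Γ i G) (hc : IsCutEdge Γ i (attach Γ i G)) (A : Finset (Fin n))
    (w : Perm (Fin n)) :
    ofCoords (pendantSpline Γ i G A) w =
      if (marked Γ i G).image w = A then X (w (attach Γ i G)) - X (w i) else 0 := by
  have hij := (h.attach_spec hΓ).2.ne
  rw [ofCoords_apply]
  unfold pendantSpline
  simp only [if_pos hc]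
  split_ifs with hA
  · rw [Finset.sum_eq_add_of_mem (attach Γ i G) i (Finset.mem_univ _) (Finset.mem_univ _) hij.symm]
    · rw [if_pos rfl, if_neg hij, if_pos rfl, one_smul, neg_smul, one_smul, sub_eq_add_neg]
    · intro p _ hp
      rw [if_neg hp.1, if_neg hp.2, zero_smul]
  · simp

theorem ofCoords_pendantSpline_of_not_isCutEdge {i : Fin n} {G : Set (Fin n)}
    (h : IsComponentOfDelete Γ i G) (hc : ¬ IsCutEdge Γ i (attach Γ i G)) (k : Fin n) :
    ofCoords (pendantSpline Γ i G {k}) = yBar i G k := by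
  funext w
  rw [ofCoords_apply]
  unfold pendantSpline yBar
  have hk : ∀ q, ({k} : Finset (Fin n)) = {w q} ↔ q = w⁻¹ k := by
    intro q
    rw [Finset.singleton_inj, Perm.eq_inv_iff_eq, eq_comm]
  simp only [if_neg hc]
  by_cases hG : w⁻¹ k ∈ G
  · have hne : w⁻¹ k ≠ i := fun e => h.notMem (e ▸ hG)
    rw [if_pos hG,
      Finset.sum_eq_add_of_mem (w⁻¹ k) i (Finset.mem_univ _) (Finset.mem_univ _) hne]
    · rw [if_neg hne, if_pos ⟨hG, (hk _).2 rfl⟩, if_pos rfl, if_pos ⟨_, hG, (hk _).2 rfl⟩, one_smul,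
        neg_smul, one_smul, sub_eq_add_neg]
      simp
    · intro p _ hp
      rw [if_neg hp.2, if_neg (fun h' => hp.1 ((hk _).1 h'.2)), zero_smul]
  · rw [if_neg hG]
    refine Finset.sum_eq_zero fun p _ => ?_
    by_cases hp : p = i
    · rw [if_pos hp, if_neg, zero_smul]
      rintro ⟨q, hq, hq'⟩
      exact hG ((hk q).1 hq' ▸ hq)
    · rw [if_neg hp, if_neg, zero_smul]
      rintro ⟨hq, hq'⟩
      exact hG ((hk p).1 hq' ▸ hq)

theorem ofCoords_pendantSpline_mem_span {i : Fin n} {G : Set (Fin n)} (hΓ : Γ.Connected)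
    (h : IsComponentOfDelete Γ i G) {A : Finset (Fin n)} (hA : A.card = (marked Γ i G).card) :
    ofCoords (pendantSpline Γ i G A) ∈ Submodule.span ℂ (linearGenerators Γ) := by
  by_cases hc : IsCutEdge Γ i (attach Γ i G)
  · obtain ⟨hj, hij⟩ := h.attach_spec hΓ
    have hG := coe_marked_of_isCutEdge hc
    have hAn : (A : Set (Fin n)).ncard = G.ncard := by
      rw [Set.ncard_coe_finset, hA, card_marked_of_isCutEdge hc]
    -- The generators use only `i < j`. If the edge is oriented the other way, pass to the
    -- complement of `A`, which changes the sign.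
    rcases lt_or_gt_of_ne hij.ne with hlt | hlt
    · have e : ofCoords (pendantSpline Γ i G A) =
          - fBar Γ i (attach Γ i G) ((A : Set (Fin n))ᶜ) := by
        funext w
        rw [ofCoords_pendantSpline_of_isCutEdge hΓ h hc, Pi.neg_apply]
        unfold fBar
        rw [h.cutEdgeComponent_eq_compl hΓ hj hc, Set.preimage_compl]
        simp only [compl_inj_iff, preimage_eq_iff_image_eq hG]
        split_ifs
        · ring
        · rw [neg_zero]
      rw [e]
      refine neg_mem (Submodule.subset_span (Or.inl (Or.inr ⟨_, _, _, hlt, hc, ?_, rfl⟩)))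
      rw [h.cutEdgeComponent_eq_compl hΓ hj hc, Set.ncard_compl, Set.ncard_compl, hAn]
    · have e : ofCoords (pendantSpline Γ i G A) = fBar Γ (attach Γ i G) i A := by
        funext w
        rw [ofCoords_pendantSpline_of_isCutEdge hΓ h hc]
        unfold fBar
        rw [h.cutEdgeComponent_eq hΓ hj hc]
        simp only [preimage_eq_iff_image_eq hG]
      rw [e]
      refine Submodule.subset_span (Or.inl (Or.inr ⟨_, _, _, hlt, isCutEdge_comm.1 hc, ?_, rfl⟩))
      rw [h.cutEdgeComponent_eq hΓ hj hc, hAn]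
  · rw [marked_of_not_isCutEdge hc, Finset.card_singleton, Finset.card_eq_one] at hA
    obtain ⟨k, rfl⟩ := hA
    rw [ofCoords_pendantSpline_of_not_isCutEdge h hc]
    exact yBar_mem_span_linearGenerators h k

theorem pendantSpline_mem {i : Fin n} {G : Set (Fin n)} (hΓ : Γ.Connected)
    (h : IsComponentOfDelete Γ i G) {A : Finset (Fin n)} (hA : A.card = (marked Γ i G).card) :
    pendantSpline Γ i G A ∈ coordSplines Γ :=
  ofCoords_mem_splines_iff.1
    (span_linearGenerators_le Γ (ofCoords_pendantSpline_mem_span hΓ h hA)).1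

theorem jump_pendantSpline {i : Fin n} {G : Set (Fin n)} (hΓ : Γ.Connected)
    (h : IsComponentOfDelete Γ i G) (A : Finset (Fin n)) (w : Perm (Fin n)) :
    jump i (attach Γ i G) (pendantSpline Γ i G A) w =
      (if (marked Γ i G).image w = A then 1 else 0) -
        (if (marked Γ i G).image (w * swap i (attach Γ i G) : Perm (Fin n)) = A then 1 else 0) := by
  obtain ⟨hj, hij⟩ := h.attach_spec hΓ
  rw [jump_apply]
  unfold pendantSpline
  by_cases hc : IsCutEdge Γ i (attach Γ i G)
  · simp only [if_pos hc, if_true]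
  · simp only [if_neg hc, if_neg hij.ne', marked_of_not_isCutEdge hc, Finset.image_singleton, hj,
      true_and, @eq_comm _ A]

/-- Only the coordinates at the two ends of the cut edge are nonzero. Any other edge has an end
outside these two, and its jump can be read there. -/
theorem jump_pendantSpline_eq_zero_of_isCutEdge {i i' j' : Fin n} {G : Set (Fin n)}
    (hΓ : Γ.Connected) (h : IsComponentOfDelete Γ i G) (hc : IsCutEdge Γ i (attach Γ i G))
    {A : Finset (Fin n)} (hA : A.card = (marked Γ i G).card) (hij' : Γ.Adj i' j')
    (hne : s(i', j') ≠ s(i, attach Γ i G)) : jump i' j' (pendantSpline Γ i G A) = 0 := by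
  have hz : ∀ p, p ≠ i → p ≠ attach Γ i G → ∀ w, pendantSpline Γ i G A p w = 0 := by
    intro p hp hp' w
    unfold pendantSpline
    rw [if_pos hc, if_neg hp', if_neg hp, ite_self]
  funext w
  by_cases hj : j' ≠ i ∧ j' ≠ attach Γ i G
  · rw [jump_apply, hz _ hj.1 hj.2, hz _ hj.1 hj.2, sub_zero, Pi.zero_apply]
  · have hi : i' ≠ i ∧ i' ≠ attach Γ i G := by
      have := hij'.ne
      constructor
      · rintro rfl
        apply hj
        refine ⟨this.symm, ?_⟩
        rintro rfl
        exact hne rfl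
      · rintro rfl
        apply hj
        refine ⟨?_, this.symm⟩
        rintro rfl
        exact hne Sym2.eq_swap
    rw [jump_eq (pendantSpline_mem hΓ h hA) hij', hz _ hi.1 hi.2, hz _ hi.1 hi.2, sub_zero,
      Pi.zero_apply]

/-- The spline is supported on the coordinates in `G ∪ {i}`. An edge avoiding `G` has an end outside
this set, where its jump is read. -/
theorem jump_pendantSpline_eq_zero_of_notMem {i i' j' : Fin n} {G : Set (Fin n)}
    (hΓ : Γ.Connected) (h : IsComponentOfDelete Γ i G) (hc : ¬ IsCutEdge Γ i (attach Γ i G))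
    {A : Finset (Fin n)} (hA : A.card = (marked Γ i G).card) (hij' : Γ.Adj i' j')
    (hi' : i' ∉ G) (hj' : j' ∉ G) : jump i' j' (pendantSpline Γ i G A) = 0 := by
  have hz : ∀ p, p ≠ i → p ∉ G → ∀ w, pendantSpline Γ i G A p w = 0 := by
    intro p hp hp' w
    unfold pendantSpline
    rw [if_neg hc, if_neg hp, if_neg fun h' => hp' h'.1]
  funext w
  by_cases hj : j' = i
  · have hi : i' ≠ i := fun e => hij'.ne (e.trans hj.symm)
    rw [jump_eq (pendantSpline_mem hΓ h hA) hij', hz _ hi hi', hz _ hi hi', sub_zero,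
      Pi.zero_apply]
  · rw [jump_apply, hz _ hj hj', hz _ hj hj', sub_zero, Pi.zero_apply]

end Generators

/-! ### Potentials modulo constants, and the dimension formula -/

section Dimension

open Equiv

variable {n : ℕ} {Γ : SimpleGraph (Fin n)}

/-- The sets of the same size as `S`, other than `S`. -/
abbrev SameCard (S : Finset (Fin n)) : Type := {A : Finset (Fin n) // A.card = S.card ∧ A ≠ S}

theorem card_sameCard (S : Finset (Fin n)) :
    Fintype.card (SameCard S) = n.choose S.card - 1 := by
  rw [Fintype.card_subtype]
  have : Finset.univ.filter (fun A : Finset (Fin n) => A.card = S.card ∧ A ≠ S) =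
      ((Finset.univ : Finset (Fin n)).powersetCard S.card).erase S := by
    ext A
    simp [Finset.mem_powersetCard, and_comm]
  rw [this, Finset.card_erase_of_mem (by simp [Finset.mem_powersetCard]), Finset.card_powersetCard,
    Finset.card_univ, Fintype.card_fin]

/-- Extension by zero. -/
def extendByZero (S : Finset (Fin n)) (u : SameCard S → ℂ) (B : Finset (Fin n)) : ℂ :=
  if h : B.card = S.card ∧ B ≠ S then u ⟨B, h⟩ else 0

theorem sum_mul_ite_eq_extendByZero (S : Finset (Fin n)) (u : SameCard S → ℂ)
    (B : Finset (Fin n)) :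
    ∑ A : SameCard S, u A * (if B = A.1 then 1 else 0) = extendByZero S u B := by
  unfold extendByZero
  split_ifs with h
  · rw [Finset.sum_eq_single_of_mem (⟨B, h⟩ : SameCard S) (Finset.mem_univ _)]
    · rw [if_pos rfl, mul_one]
    · intro A _ hA
      rw [if_neg fun e => hA (Subtype.ext e.symm), mul_zero]
  · refine Finset.sum_eq_zero fun A _ => ?_
    rw [if_neg, mul_zero]
    rintro rfl
    exact h A.2

/-- The difference of the values of a function of sets on the two images of `S` under `w` and under
`w (i, j)`. -/
def coboundary (S : Finset (Fin n)) (i j : Fin n) :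
    (SameCard S → ℂ) →ₗ[ℂ] (Perm (Fin n) → ℂ) where
  toFun u := fun w => extendByZero S u (S.image w) -
    extendByZero S u (S.image (w * swap i j : Perm (Fin n)))
  map_add' u v := by
    funext w
    simp only [← sum_mul_ite_eq_extendByZero, Pi.add_apply, add_mul, Finset.sum_add_distrib]
    ring
  map_smul' c u := by
    funext w
    simp only [← sum_mul_ite_eq_extendByZero, Pi.smul_apply, smul_eq_mul, mul_assoc,
      ← Finset.mul_sum, RingHom.id_apply]
    ring

theorem coboundary_apply (S : Finset (Fin n)) (i j : Fin n) (u : SameCard S → ℂ)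
    (w : Perm (Fin n)) : coboundary S i j u w = extendByZero S u (S.image w) -
    extendByZero S u (S.image (w * swap i j : Perm (Fin n))) := rfl

theorem eq_coboundary {S : Finset (Fin n)} {i j : Fin n} {D : Perm (Fin n) → ℂ}
    {u : Finset (Fin n) → ℂ}
    (hu : ∀ w : Perm (Fin n), D w = u (S.image w) - u (S.image (w * swap i j : Perm (Fin n)))) :
    D ∈ LinearMap.range (coboundary S i j) := by
  -- Normalise the potential to vanish at `S`, in agreement with extension by zero.
  refine ⟨fun A => u A.1 - u S, ?_⟩
  have key : ∀ w : Perm (Fin n),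
      extendByZero S (fun A => u A.1 - u S) (S.image w) = u (S.image w) - u S := by
    intro w
    unfold extendByZero
    split_ifs with h
    · rfl
    · have : S.image w = S := by
        by_contra hne
        exact h ⟨Finset.card_image_of_injective _ w.injective, hne⟩
      rw [this, sub_self]
  funext w
  rw [coboundary_apply, key, key, hu]
  ring

/-- If the coboundary vanishes, `w ↦ u(wS)` is invariant under `(i, j)`, and always under
permutations within `S` and within its complement. Together these generate the symmetric group, so
`u` is constant and equals its value `0` at `S`. -/
theorem coboundary_injective {S : Finset (Fin n)} {i j : Fin n} (hj : j ∈ S) (hi : i ∉ S) :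
    Function.Injective (coboundary S i j) := by
  rw [← LinearMap.ker_eq_bot, LinearMap.ker_eq_bot']
  intro u hu
  let f : Perm (Fin n) → ℂ := fun w => extendByZero S u (S.image w)
  let H : SimpleGraph (Fin n) :=
    { Adj := fun x y => x ≠ y ∧ ((x ∈ S ↔ y ∈ S) ∨ s(x, y) = s(i, j))
      symm := ⟨fun x y h => ⟨h.1.symm, h.2.imp Iff.symm fun e => by rw [Sym2.eq_swap, e]⟩⟩
      loopless := ⟨fun x h => h.1 rfl⟩ }
  have hij : i ≠ j := by rintro rfl; exact hi hj
  have hsw : swap i j ∈ invariants f := by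
    intro w
    have := congrFun hu w
    rw [coboundary_apply, Pi.zero_apply, sub_eq_zero] at this
    exact this.symm
  have hK : ∀ x y, H.Adj x y → swap x y ∈ invariants f := by
    rintro x y ⟨-, h | h⟩
    · intro w
      have : S.image (w * swap x y : Perm (Fin n)) = S.image w := by
        rw [Perm.coe_mul, ← Finset.image_image]
        congr 1
        refine Finset.eq_of_subset_of_card_le ?_
          (Finset.card_image_of_injective _ (swap x y).injective).ge
        intro z hz
        obtain ⟨t, ht, rfl⟩ := Finset.mem_image.1 hz
        rcases eq_or_ne t x with rfl | htx
        · rw [swap_apply_left]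
          exact h.1 ht
        rcases eq_or_ne t y with rfl | hty
        · rw [swap_apply_right]
          exact h.2 ht
        · rwa [swap_apply_of_ne_of_ne htx hty]
      simp only [f, this]
    · rcases Sym2.eq_iff.1 h with ⟨rfl, rfl⟩ | ⟨rfl, rfl⟩
      · exact hsw
      · rw [swap_comm]
        exact hsw
  have hreach : ∀ x, H.Reachable x i := by
    intro x
    by_cases hx : x ∈ S
    · have hji : H.Reachable j i := Adj.reachable (G := H) ⟨hij.symm, Or.inr Sym2.eq_swap⟩
      rcases eq_or_ne x j with rfl | hxj
      · exact hji
      · exact (Adj.reachable (G := H) ⟨hxj, Or.inl (by simp [hx, hj])⟩).trans hji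
    · rcases eq_or_ne x i with rfl | hxi
      · exact Reachable.refl _
      · exact Adj.reachable (G := H) ⟨hxi, Or.inl (by simp [hx, hi])⟩
  funext A
  obtain ⟨w, hw⟩ := exists_perm_image_eq A.2.1.symm
  have h1 : f (1 * w) = f 1 := mem_subgroup_of_forall_reachable (invariants f) H hK
    (fun x => (hreach x).trans (hreach _).symm) 1
  simp only [f, one_mul, hw, Perm.coe_one, Finset.image_id] at h1
  unfold extendByZero at h1
  rw [dif_pos A.2, dif_neg (fun h => h.2 rfl)] at h1
  exact h1

/-- The pairs of a vertex `i` and a component of `Γ - i` that does not contain the root `r`. -/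
abbrev Pendant (Γ : SimpleGraph (Fin n)) (r : Fin n) : Type :=
  {π : Fin n × Set (Fin n) // IsComponentOfDelete Γ π.1 π.2 ∧ r ∉ π.2}

instance (Γ : SimpleGraph (Fin n)) (r : Fin n) : Fintype (Pendant Γ r) := Fintype.ofFinite _

/-- The space of coefficients of the basis of linear splines with respect to the root `r`. -/
abbrev Coefficients (Γ : SimpleGraph (Fin n)) (r : Fin n) : Type :=
  (Fin n → ℂ) × ((π : Pendant Γ r) → SameCard (marked Γ π.1.1 π.1.2) → ℂ)

/-- Linear combinations of the splines attached to a pendant pair. -/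
def pendantCombination (Γ : SimpleGraph (Fin n)) (i : Fin n) (G : Set (Fin n)) :
    (SameCard (marked Γ i G) → ℂ) →ₗ[ℂ] (Fin n → Perm (Fin n) → ℂ) :=
  Fintype.linearCombination ℂ (fun A : SameCard (marked Γ i G) => pendantSpline Γ i G A.1)

theorem pendantCombination_apply (i : Fin n) (G : Set (Fin n))
    (u : SameCard (marked Γ i G) → ℂ) :
    pendantCombination Γ i G u = ∑ A, u A • pendantSpline Γ i G A.1 := rfl

theorem jump_pendantCombination {i : Fin n} {G : Set (Fin n)} (hΓ : Γ.Connected)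
    (h : IsComponentOfDelete Γ i G) (u : SameCard (marked Γ i G) → ℂ) :
    jump i (attach Γ i G) (pendantCombination Γ i G u) =
      coboundary (marked Γ i G) i (attach Γ i G) u := by
  funext w
  rw [pendantCombination_apply, map_sum, Finset.sum_apply, coboundary_apply,
    ← sum_mul_ite_eq_extendByZero, ← sum_mul_ite_eq_extendByZero, ← Finset.sum_sub_distrib]
  refine Finset.sum_congr rfl fun A _ => ?_
  rw [map_smul, Pi.smul_apply, jump_pendantSpline hΓ h, smul_eq_mul, mul_sub]

/-- The coordinates of `x̄_p`. -/
def xCoord (p : Fin n) : Fin n → Perm (Fin n) → ℂ := fun q _ => if q = p then 1 else 0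

theorem ofCoords_xCoord (p : Fin n) : ofCoords (xCoord p) = xBar p := by
  funext w
  rw [ofCoords_apply]
  unfold xCoord xBar
  simp

theorem jump_xCoord (i j p : Fin n) : jump i j (xCoord p) = 0 := by
  funext w
  rw [jump_apply]
  simp [xCoord]

/-- The linear combination of the basis of linear splines with given coefficients. -/
def combination (Γ : SimpleGraph (Fin n)) (r : Fin n) :
    Coefficients Γ r →ₗ[ℂ] (Fin n → Perm (Fin n) → ℂ) :=
  LinearMap.coprod (Fintype.linearCombination ℂ xCoord)
    (LinearMap.lsum ℂ _ ℂ fun π : Pendant Γ r => pendantCombination Γ π.1.1 π.1.2)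

theorem combination_apply (r : Fin n) (c : Coefficients Γ r) :
    combination Γ r c =
      ∑ p, c.1 p • xCoord p + ∑ π : Pendant Γ r, pendantCombination Γ π.1.1 π.1.2 (c.2 π) := by
  simp [combination, Fintype.linearCombination_apply]

theorem ofCoords_combination_mem (hΓ : Γ.Connected) (r : Fin n) (c : Coefficients Γ r) :
    ofCoords (combination Γ r c) ∈ Submodule.span ℂ (linearGenerators Γ) := by
  rw [combination_apply, map_add, map_sum, map_sum]
  refine add_mem (sum_mem fun p _ => ?_) (sum_mem fun π _ => ?_)
  · rw [map_smul, ofCoords_xCoord]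
    exact Submodule.smul_mem _ _ (Submodule.subset_span (Or.inl (Or.inl (Or.inr ⟨p, rfl⟩))))
  · rw [pendantCombination_apply, map_sum]
    refine sum_mem fun A _ => ?_
    rw [map_smul]
    exact Submodule.smul_mem _ _ (ofCoords_pendantSpline_mem_span hΓ π.2.1 A.2.1)

theorem jump_combination (r i j : Fin n) (c : Coefficients Γ r) :
    jump i j (combination Γ r c) =
      ∑ π : Pendant Γ r, jump i j (pendantCombination Γ π.1.1 π.1.2 (c.2 π)) := by
  rw [combination_apply, map_add, map_sum, map_sum]
  simp [jump_xCoord]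

/-- The jumps at the chosen edges form a triangular system with injective diagonal blocks. The
coefficients at non-cut edges vanish by induction on the distance from `r`; after that the cut edges
do not interact. -/
theorem combination_injective (hΓ : Γ.Connected) (r : Fin n) :
    Function.Injective (combination Γ r) := by
  rw [← LinearMap.ker_eq_bot, LinearMap.ker_eq_bot']
  intro c hc
  have key : ∀ π : Pendant Γ r, (∀ π' : Pendant Γ r, π' ≠ π →
      jump π.1.1 (attach Γ π.1.1 π.1.2) (pendantCombination Γ π'.1.1 π'.1.2 (c.2 π')) = 0) →
      c.2 π = 0 := by
    intro π hπ
    have h1 := jump_combination r π.1.1 (attach Γ π.1.1 π.1.2) c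
    rw [hc, map_zero, Finset.sum_eq_single_of_mem π (Finset.mem_univ _) fun π' _ => hπ π',
      jump_pendantCombination hΓ π.2.1] at h1
    exact coboundary_injective (attach_mem_marked hΓ π.2.1) (notMem_marked hΓ π.2.1)
      (h1.symm.trans (map_zero _).symm)
  have hcut : ∀ (π' : Pendant Γ r) {i j : Fin n},
      IsCutEdge Γ π'.1.1 (attach Γ π'.1.1 π'.1.2) → Γ.Adj i j →
      s(i, j) ≠ s(π'.1.1, attach Γ π'.1.1 π'.1.2) →
      jump i j (pendantCombination Γ π'.1.1 π'.1.2 (c.2 π')) = 0 := by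
    intro π' i j hc' hij hne
    rw [pendantCombination_apply, map_sum]
    refine Finset.sum_eq_zero fun A _ => ?_
    rw [map_smul, jump_pendantSpline_eq_zero_of_isCutEdge hΓ π'.2.1 hc' A.2.1 hij hne, smul_zero]
  have hncut : ∀ (d : ℕ) (π : Pendant Γ r), Γ.dist π.1.1 r = d →
      ¬ IsCutEdge Γ π.1.1 (attach Γ π.1.1 π.1.2) → c.2 π = 0 := by
    intro d
    induction d using Nat.strong_induction_on with
    | _ d ih =>
      intro π hd hπ
      obtain ⟨hj, hij⟩ := π.2.1.attach_spec hΓ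
      refine key π fun π' hne => ?_
      by_cases hc' : IsCutEdge Γ π'.1.1 (attach Γ π'.1.1 π'.1.2)
      · refine hcut π' hc' hij fun e => hπ ?_
        rcases Sym2.eq_iff.1 e with ⟨e1, e2⟩ | ⟨e1, e2⟩
        · rw [e2, e1]
          exact hc'
        · rw [e2, e1]
          exact isCutEdge_comm.1 hc'
      -- The spline of `π'` can only affect the edge of `π` if that edge meets its component. Then
      -- either `π'` sits at a vertex closer to `r`, where its coefficients are already zero, or `π'
      -- = π`.
      · by_cases hi' : π.1.1 ∈ π'.1.2
        · have := π'.2.1.dist_lt hΓ π'.2.2 hi'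
          rw [ih _ (hd ▸ this) π' rfl hc', map_zero, map_zero]
        · by_cases hj' : attach Γ π.1.1 π.1.2 ∈ π'.1.2
          · exfalso
            have e : π.1.1 = π'.1.1 := by
              by_contra hne'
              exact hi' (π'.2.1.mem_of_adj hj' hij.symm hne')
            refine hne (Subtype.ext (Prod.ext e.symm ?_))
            have h2 := π'.2.1
            rw [← e] at h2
            exact h2.eq_of_mem π.2.1 hj' hj
          · rw [pendantCombination_apply, map_sum]
            refine Finset.sum_eq_zero fun A _ => ?_
            rw [map_smul, jump_pendantSpline_eq_zero_of_notMem hΓ π'.2.1 hc' A.2.1 hij hi' hj',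
              smul_zero]
  have hall : ∀ π : Pendant Γ r, c.2 π = 0 := by
    intro π
    obtain ⟨hj, hij⟩ := π.2.1.attach_spec hΓ
    refine key π fun π' hne => ?_
    by_cases hc' : IsCutEdge Γ π'.1.1 (attach Γ π'.1.1 π'.1.2)
    · refine hcut π' hc' hij fun e => ?_
      obtain ⟨hj', hij'⟩ := π'.2.1.attach_spec hΓ
      rcases Sym2.eq_iff.1 e with ⟨e1, e2⟩ | ⟨e1, e2⟩
      · refine hne (Subtype.ext (Prod.ext e1.symm ?_))
        have h2 := π'.2.1
        rw [← e1] at h2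
        exact h2.eq_of_mem π.2.1 (e2 ▸ hj') hj
      -- The same cut edge chosen from both ends would give two pendant sides, but one of the sides
      -- contains `r`.
      · rcases reachable_isolate_or hΓ hij.ne r with h3 | h3
        · exact π.2.2 ((π.2.1.mem_iff hj).2 h3.symm)
        · rw [e2] at h3
          rw [e1] at h3
          exact π'.2.2 ((π'.2.1.mem_iff hj').2 h3.symm)
    · rw [hncut _ π' rfl hc', map_zero, map_zero]
  rw [combination_apply] at hc
  simp only [hall, map_zero, Finset.sum_const_zero, add_zero] at hc
  refine Prod.ext (funext fun p => ?_) (funext hall)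
  have := congrFun (congrFun hc p) 1
  simpa [xCoord] using this

theorem finrank_coefficients (r : Fin n) :
    Module.finrank ℂ (Coefficients Γ r) =
      n + ∑ π : Pendant Γ r, (n.choose (marked Γ π.1.1 π.1.2).card - 1) := by
  rw [Module.finrank_prod, Module.finrank_fin_fun, Module.finrank_pi_fintype]
  congr 1
  refine Finset.sum_congr rfl fun π _ => ?_
  rw [Module.finrank_fintype_fun_eq_card, card_sameCard]

/-- A spline is determined by its coordinates at the identity and its jumps at the chosen edges, and
each jump lies in the range of a coboundary map. -/
theorem finrank_coordSplines_le (hΓ : Γ.Connected) (r : Fin n) :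
    Module.finrank ℂ (coordSplines Γ) ≤ Module.finrank ℂ (Coefficients Γ r) := by
  let T : Pendant Γ r → Submodule ℂ (Perm (Fin n) → ℂ) := fun π =>
    LinearMap.range (coboundary (marked Γ π.1.1 π.1.2) π.1.1 (attach Γ π.1.1 π.1.2))
  let R : coordSplines Γ →ₗ[ℂ] (Fin n → ℂ) × ((π : Pendant Γ r) → T π) :=
    LinearMap.prod
      (LinearMap.pi fun p => (LinearMap.proj (1 : Perm (Fin n))).comp
        ((LinearMap.proj p).comp (coordSplines Γ).subtype))
      (LinearMap.pi fun π => LinearMap.codRestrict (T π)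
        ((jump π.1.1 (attach Γ π.1.1 π.1.2)).comp (coordSplines Γ).subtype) (by
          intro a
          obtain ⟨u, hu⟩ := exists_jump_potential hΓ π.2.1 a.2
          exact eq_coboundary hu))
  have hR : Function.Injective R := by
    rw [← LinearMap.ker_eq_bot, LinearMap.ker_eq_bot']
    intro a ha
    have h1 : ∀ p, a.1 p 1 = 0 := fun p => congrFun (congrArg Prod.fst ha) p
    have h2 : ∀ π : Pendant Γ r, jump π.1.1 (attach Γ π.1.1 π.1.2) a.1 = 0 := fun π =>
      congrArg Subtype.val (congrFun (congrArg Prod.snd ha) π)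
    refine Subtype.ext (funext fun p => funext fun w => ?_)
    rw [eq_const_of_jump_eq_zero hΓ a.2 r (fun i G hG hr =>
      ⟨attach Γ i G, (hG.attach_spec hΓ).1, (hG.attach_spec hΓ).2, h2 ⟨(i, G), hG, hr⟩⟩) p w]
    exact h1 p
  refine (LinearMap.finrank_le_finrank_of_injective hR).trans ?_
  rw [Module.finrank_prod, Module.finrank_prod]
  refine Nat.add_le_add_left ?_ _
  rw [Module.finrank_pi_fintype, Module.finrank_pi_fintype]
  exact Finset.sum_le_sum fun (π : Pendant Γ r) _ => LinearMap.finrank_range_le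
    (coboundary (marked Γ π.1.1 π.1.2) π.1.1 (attach Γ π.1.1 π.1.2))

theorem range_combination (hΓ : Γ.Connected) (r : Fin n) :
    LinearMap.range (combination Γ r) = coordSplines Γ := by
  refine Submodule.eq_of_le_of_finrank_le ?_ ?_
  · rintro _ ⟨c, rfl⟩
    exact ofCoords_mem_splines_iff.1
      (span_linearGenerators_le Γ (ofCoords_combination_mem hΓ r c)).1
  · rw [LinearMap.finrank_range_of_inj (combination_injective hΓ r)]
    exact finrank_coordSplines_le hΓ r

/-- The linear splines are spanned by the generators. -/
theorem span_linearGenerators (hΓ : Γ.Connected) :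
    Submodule.span ℂ (linearGenerators Γ) = splinesOfDegree Γ 1 := by
  refine le_antisymm (span_linearGenerators_le Γ) ?_
  obtain ⟨r⟩ := hΓ.nonempty
  rw [splinesOfDegree_one_eq_map, ← range_combination hΓ r]
  rintro _ ⟨_, ⟨c, rfl⟩, rfl⟩
  exact ofCoords_combination_mem hΓ r c

/-- The dimension of the space of linear splines. -/
theorem finrank_splines_eq (hΓ : Γ.Connected) (r : Fin n) :
    Module.finrank ℂ (splinesOfDegree Γ 1) =
      n + ∑ π : Pendant Γ r, (n.choose (marked Γ π.1.1 π.1.2).card - 1) := by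
  rw [finrank_splinesOfDegree_one, ← range_combination hΓ r,
    LinearMap.finrank_range_of_inj (combination_injective hΓ r), finrank_coefficients]

end Dimension

/-! ### Blocks of cliqued graphs -/

section Blocks

variable {V : Type*} {Γ : SimpleGraph V}

theorem isTwoConnected_of_isClique {s : Set V} (hs : s.Nonempty) (h : Γ.IsClique s) :
    IsTwoConnected (Γ.induce s) := by
  have hadj : ∀ x y : s, x ≠ y → (Γ.induce s).Adj x y := fun x y hxy =>
    h x.2 y.2 fun e => hxy (Subtype.ext e)
  have := hs.to_subtype
  refine ⟨⟨fun x y => ?_⟩, fun v x y => ?_⟩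
  · by_cases hxy : x = y
    · exact hxy ▸ Reachable.refl _
    · exact (hadj x y hxy).reachable
  · by_cases hxy : x = y
    · exact hxy ▸ Reachable.refl _
    · have : ((Γ.induce s).induce {v}ᶜ).Adj x y := hadj _ _ fun e => hxy (Subtype.ext e)
      exact this.reachable

/-- The path `x, y, z` and a path avoiding `y` meet only at their ends, so the cliqued condition
applies. -/
theorem IsCliqued.adj_of_reachable_isolate (hc : IsCliqued Γ) {x y z : V} (hxy : Γ.Adj x y)
    (hyz : Γ.Adj y z) (hxz : x ≠ z) (h : (isolate Γ y).Reachable x z) : Γ.Adj x z := by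
  obtain ⟨p, hp⟩ := h.exists_isPath
  have hle : isolate Γ y ≤ Γ := fun _ _ h => h.1
  have hy : y ∉ p.support := by
    intro hy
    have hsupp : ∀ {a b : V} (q : (isolate Γ y).Walk a b), a ≠ y → y ∉ q.support := by
      intro a b q
      induction q with
      | nil => intro ha h'; exact ha (by simpa [eq_comm] using h')
      | cons h q ih =>
        intro ha h'
        rw [Walk.support_cons, List.mem_cons] at h'
        exact h'.elim (fun e => ha e.symm) (ih h.2.2)
    exact hsupp p hxy.ne hy
  have hq : (Walk.cons hxy (Walk.cons hyz Walk.nil)).IsPath := by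
    simp [Walk.cons_isPath_iff, hxy.ne, hyz.ne, hxz]
  refine hc x z hxz ⟨⟨p.mapLe hle, hp.mapLe hle⟩, ⟨_, hq⟩, ?_, ?_⟩
  · intro e
    have e' := congrArg (fun P : Γ.Path x z => y ∈ P.1.support) e
    simp only [Walk.support_mapLe_eq_support, Walk.support_cons, Walk.support_nil, eq_iff_iff] at e'
    exact hy (e'.2 (by simp))
  · intro t ht ht'
    simp only [Walk.support_mapLe_eq_support] at ht
    simp only [Walk.support_cons, Walk.support_nil, List.mem_cons, List.not_mem_nil, or_false] at ht'
    rcases ht' with rfl | rfl | rfl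
    · exact Or.inl rfl
    · exact absurd ht hy
    · exact Or.inr rfl

/-- Adjacency propagates along a walk: if `x` is adjacent to `y` and `y` to `z`, then
2-connectedness gives a route from `x` to `z` avoiding `y`. -/
theorem IsCliqued.isClique (hc : IsCliqued Γ) {s : Set V} (hs : IsTwoConnected (Γ.induce s)) :
    Γ.IsClique s := by
  have key : ∀ {x z : s}, (Γ.induce s).Walk x z → x = z ∨ Γ.Adj x z := by
    intro x z p
    induction p with
    | nil => exact Or.inl rfl
    | @cons x y z hxy p ih =>
      rcases ih with rfl | hyz
      · exact Or.inr hxy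
      by_cases hxz : x = z
      · exact Or.inl hxz
      refine Or.inr (hc.adj_of_reachable_isolate hxy hyz (fun e => hxz (Subtype.ext e)) ?_)
      have h1 : x ≠ y := (show (Γ.induce s).Adj x y from hxy).ne
      have h2 : z ≠ y := fun e => hyz.ne (congrArg Subtype.val e.symm)
      exact (hs.2 y ⟨x, h1⟩ ⟨z, h2⟩).map
        (⟨fun t => t.1.1, fun {a b} hab => ⟨hab, fun e => a.2 (Subtype.ext e),
          fun e => b.2 (Subtype.ext e)⟩⟩ : (Γ.induce s).induce {y}ᶜ →g isolate Γ y)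
  intro x hx z hz hxz
  obtain ⟨p⟩ := hs.1.preconnected ⟨x, hx⟩ ⟨z, hz⟩
  exact (key p).resolve_left fun e => hxz (congrArg Subtype.val e)

/-- In a cliqued graph, the neighbours of a vertex of a block that is not a cut vertex lie in the
block. -/
theorem IsBlock.mem_of_adj {B : Set V} (hB : IsBlock Γ B) (hc : IsCliqued Γ) {p x : V} (hp : p ∈ B)
    (hpc : ¬ IsCutVertex Γ p) (hpx : Γ.Adj p x) : x ∈ B := by
  have hcl := hc.isClique hB.prop
  have hx : ∀ y ∈ B, x ≠ y → Γ.Adj x y := by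
    intro y hy hxy
    rcases eq_or_ne y p with rfl | hyp
    · exact hpx.symm
    · refine hc.adj_of_reachable_isolate hpx.symm (hcl hp hy hyp.symm) hxy ?_
      by_contra hn
      exact hpc (isCutVertex_iff.2 ⟨x, y, hpx.ne', hyp, hn⟩)
  -- Adding `x` keeps a clique, hence a 2-connected set, so maximality of the block forces `x ∈ B`.
  have h2 : IsTwoConnected (Γ.induce (insert x B)) :=
    isTwoConnected_of_isClique (Set.insert_nonempty _ _) (isClique_insert.2 ⟨hcl, hx⟩)
  exact hB.le_of_ge h2 (Set.subset_insert _ _) (Set.mem_insert _ _)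

theorem blockCutTree_adj {v : {v : V // IsCutVertex Γ v}} {B : {B : Set V // IsBlock Γ B}} :
    (blockCutTree Γ).Adj (Sum.inl v) (Sum.inr B) ↔ (v : V) ∈ (B : Set V) := by
  unfold blockCutTree
  rw [fromRel_adj]
  constructor
  · rintro ⟨-, ⟨v', B', h1, h2, h⟩ | ⟨v', B', h1, h2, h⟩⟩
    · cases h1
      cases h2
      exact h
    · cases h1
  · intro h
    exact ⟨by simp, Or.inl ⟨v, B, rfl, rfl, h⟩⟩

theorem IsLeafBlock.eq_of_mem {B : {B : Set V // IsBlock Γ B}} (hB : IsLeafBlock Γ B) {p q : V}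
    (hp : IsCutVertex Γ p) (hq : IsCutVertex Γ q) (hpB : p ∈ (B : Set V)) (hqB : q ∈ (B : Set V)) :
    p = q := by
  obtain ⟨y, hy⟩ := Set.ncard_eq_one.1 hB
  have hmem : ∀ t (ht : IsCutVertex Γ t), t ∈ (B : Set V) → Sum.inl ⟨t, ht⟩ = y := by
    intro t ht htB
    have : Sum.inl ⟨t, ht⟩ ∈ (blockCutTree Γ).neighborSet (Sum.inr B) :=
      ((blockCutTree_adj (v := ⟨t, ht⟩)).2 htB).symm
    rwa [hy, Set.mem_singleton_iff] at this
  have := (hmem p hp hpB).trans (hmem q hq hqB).symm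
  simpa using this

theorem exists_isBlock_of_adj [Finite V] {x y : V} (h : Γ.Adj x y) :
    ∃ B : {B : Set V // IsBlock Γ B}, x ∈ (B : Set V) ∧ y ∈ (B : Set V) := by
  have h2 : IsTwoConnected (Γ.induce {x, y}) :=
    isTwoConnected_of_isClique (Set.insert_nonempty _ _) (isClique_pair.2 fun _ => h)
  obtain ⟨B, hB, hmax⟩ := Set.Finite.exists_le_maximal
    (Set.toFinite {s : Set V | IsTwoConnected (Γ.induce s)}) h2
  exact ⟨⟨B, hmax⟩, hB (Set.mem_insert _ _), hB (Set.mem_insert_of_mem _ rfl)⟩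

end Blocks

/-! ### Naturally labelled cliqued graphs -/

section NaturalLabelling

variable {m : ℕ} {Γ : SimpleGraph (Fin (m + 1))} {v : Fin (m + 1)}

/-- The vertices from `v` on form a clique attached to the rest of the graph at the cut vertex `v`
only, and the labels below `v` decrease with the distance from the last vertex. -/
structure IsEndClique (Γ : SimpleGraph (Fin (m + 1))) (v : Fin (m + 1)) : Prop where
  isCutVertex : IsCutVertex Γ v
  lt_last : v < Fin.last m
  isClique : Γ.IsClique (Set.Ici v)
  not_isCutVertex : ∀ p, v < p → ¬ IsCutVertex Γ p
  le_of_adj : ∀ p x, v < p → Γ.Adj p x → v ≤ x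
  lt_of_dist_lt : ∀ j k, j < v → k < v → Γ.dist j (Fin.last m) < Γ.dist k (Fin.last m) → k < j

theorem IsEndClique.adj_last (h : IsEndClique Γ v) {p : Fin (m + 1)} (hp : v ≤ p)
    (hp' : p ≠ Fin.last m) : Γ.Adj p (Fin.last m) :=
  h.isClique (Set.mem_Ici.2 hp) (Set.mem_Ici.2 (Fin.le_last v)) hp'

theorem Ici_eq_pair (hv : (v : ℕ) + 1 = m) : Set.Ici v = {v, Fin.last m} := by
  ext x
  simp only [Set.mem_Ici, Set.mem_insert_iff, Set.mem_singleton_iff, Fin.le_def, Fin.ext_iff,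
    Fin.val_last]
  omega

theorem isCutEdge_last (hΓ : Γ.Connected) (h : IsEndClique Γ v) (hv : (v : ℕ) + 1 = m) :
    IsCutEdge Γ v (Fin.last m) := by
  have hadj := h.adj_last le_rfl h.lt_last.ne
  rw [isCutEdge_comm, (isComponentOfDelete_setOf hadj.ne).isCutEdge_iff hΓ (Reachable.refl v)
    hadj.symm]
  intro q _ hq
  have h1 := h.le_of_adj _ q h.lt_last hq
  have h2 : q ∈ ({v, Fin.last m} : Set (Fin (m + 1))) := Ici_eq_pair hv ▸ Set.mem_Ici.2 h1
  exact h2.resolve_right fun e => hq.ne e.symm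

/-- A leaf block has `v` as its only cut vertex, and in a cliqued graph it is a clique whose other
vertices have no neighbours outside it. The last clause is the only place where the maximality of
`B` and the condition on non-leaf blocks are needed. -/
theorem IsNaturallyLabelled.exists_isEndClique (hΓ : Γ.Connected) (hc : IsCliqued Γ)
    (hn : IsNaturallyLabelled Γ) :
    ∃ v, IsEndClique Γ v ∧ IsBlock Γ (Set.Ici v) ∧ ((v : ℕ) + 1 = m → IsTypeA Γ) := by
  obtain ⟨⟨v, hv⟩, ⟨B, hB⟩, hsub, hvB, hleaf, hmax, hlast, hne, hBv, -, hdist⟩ := hn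
  rw [blockCutTree_adj] at hvB
  simp only at hvB hlast hne hBv hdist
  have hcl := hc.isClique hB.prop
  have hlt : v < Fin.last m := lt_of_le_of_ne (Fin.le_last v) hne.symm
  have hnc : ∀ p, v < p → ¬ IsCutVertex Γ p := by
    intro p hp hpc
    have hpB : p ∈ B := hBv ▸ Set.mem_Ici.2 hp.le
    exact hp.ne' (hleaf.eq_of_mem hpc hv hpB hvB)
  have hend : IsEndClique Γ v := by
    refine ⟨hv, hlt, hBv ▸ hcl, hnc, ?_, ?_⟩
    · intro p x hp hpx
      have hpB : p ∈ B := hBv ▸ Set.mem_Ici.2 hp.le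
      have := hB.mem_of_adj hc hpB (hnc p hp) hpx
      rw [hBv] at this
      exact this
    · intro j k hj hk
      refine hdist j ?_ k ?_
      · rw [hBv]
        exact fun h => absurd (Set.mem_Ici.1 h) (not_le.2 hj)
      · rw [hBv]
        exact fun h => absurd (Set.mem_Ici.1 h) (not_le.2 hk)
  refine ⟨v, hend, hBv ▸ hB, fun hvm => ⟨v, hvm, isCutEdge_last hΓ hend hvm, ?_⟩⟩
  have hBcard : B.ncard = 2 := by
    rw [hBv, Ici_eq_pair hvm, Set.ncard_pair hlt.ne]
  -- Since `|B| = 2` is maximal, a leaf block at `v` is a pair `{v, x}` with `x` not a cut vertex,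
  -- and its component is `{x}`. So a larger component meets a non-leaf block at `v`, and there is
  -- at most one such block.
  have key : ∀ G : Set (Fin (m + 1)), IsComponentOfDelete Γ v G → G.ncard ≠ 1 →
      ∃ B' : {B : Set (Fin (m + 1)) // IsBlock Γ B}, v ∈ (B' : Set (Fin (m + 1))) ∧
        ¬ IsLeafBlock Γ B' ∧ ∃ x ∈ G, x ∈ (B' : Set (Fin (m + 1))) := by
    intro G hG hG1
    obtain ⟨x, hxG, hvx⟩ := hG.exists_adj hΓ
    obtain ⟨B', hvB', hxB'⟩ := exists_isBlock_of_adj hvx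
    refine ⟨B', hvB', fun hleaf' => hG1 ?_, x, hxG, hxB'⟩
    have hle := hmax B' (blockCutTree_adj.2 hvB') hleaf'
    simp only [hBcard] at hle
    have hpair : ({v, x} : Set (Fin (m + 1))) = B' := by
      refine Set.eq_of_subset_of_ncard_le ?_ (by rwa [Set.ncard_pair hvx.ne])
      rintro y (rfl | rfl)
      · exact hvB'
      · exact hxB'
    have hxc : ¬ IsCutVertex Γ x := fun h => hvx.ne' (hleaf'.eq_of_mem h hv hxB' hvB')
    refine Set.ncard_eq_one.2 ⟨x, Set.eq_singleton_iff_unique_mem.2 ⟨hxG, fun y hy => ?_⟩⟩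
    obtain ⟨p⟩ := (hG.mem_iff hxG).1 hy
    cases p with
    | nil => rfl
    | @cons _ z _ hxz p =>
      have hz := B'.2.mem_of_adj hc hxB' hxc hxz.1
      rw [← hpair] at hz
      rcases hz with rfl | rfl
      · exact absurd rfl hxz.2.2
      · exact absurd hxz.1 (Γ.irrefl)
  intro G hG G' hG'
  obtain ⟨B₁, hv1, hl1, x₁, hx1, hx1'⟩ := key G hG.1 hG.2
  obtain ⟨B₂, hv2, hl2, x₂, hx2, hx2'⟩ := key G' hG'.1 hG'.2
  have e := hsub ⟨blockCutTree_adj.2 hv1, hl1⟩ ⟨blockCutTree_adj.2 hv2, hl2⟩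
  subst e
  have hx : x₁ ∈ G' := by
    rcases eq_or_ne x₂ x₁ with rfl | hne
    · exact hx2
    · exact hG'.1.mem_of_adj hx2 (hc.isClique B₁.2.prop hx2' hx1' hne)
        fun e => hG.1.notMem (e ▸ hx1)
  exact hG.1.eq_of_mem hG'.1 hx1 hx

theorem IsEndClique.isTypeB (h : IsEndClique Γ v) (hB : IsBlock Γ (Set.Ici v))
    (hv : (v : ℕ) + 2 = m) : IsTypeB Γ := by
  refine ⟨v, ⟨m - 1, by omega⟩, hv, by simp only; omega, h.isCutVertex, ?_⟩
  have : Set.Ici v = {v, ⟨m - 1, by omega⟩, Fin.last m} := by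
    ext x
    simp only [Set.mem_Ici, Set.mem_insert_iff, Set.mem_singleton_iff, Fin.le_def, Fin.ext_iff,
      Fin.val_last]
    omega
  rwa [← this]

theorem IsEndClique.isTypeC (h : IsEndClique Γ v) (hv : (v : ℕ) + 2 < m) : IsTypeC Γ := by
  refine ⟨⟨m - 2, by omega⟩, ⟨m - 1, by omega⟩, by simp only; omega, by simp only; omega, ?_, ?_, ?_,
    h.isClique.subset ?_⟩
  · exact h.not_isCutVertex _ (by rw [Fin.lt_def]; simp only; omega)
  · exact h.not_isCutVertex _ (by rw [Fin.lt_def]; simp only; omega)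
  · exact h.not_isCutVertex _ h.lt_last
  · rintro x (rfl | rfl | rfl)
    · rw [Set.mem_Ici, Fin.le_def]; simp only; omega
    · rw [Set.mem_Ici, Fin.le_def]; simp only; omega
    · exact Set.mem_Ici.2 (Fin.le_last v)

/-- If `v` were smaller, then `v`, `n - 1` and `n` would form a triangle, and `(n - 1, n)` would not
be a cut edge. -/
theorem IsEndClique.val_add_one_eq (hΓ : Γ.Connected) (h : IsEndClique Γ v) (hA : IsTypeA Γ) :
    (v : ℕ) + 1 = m := by
  obtain ⟨a, ha, hcut, -⟩ := hA
  by_contra hne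
  have hlt := h.lt_last
  rw [Fin.lt_def, Fin.val_last] at hlt
  have hva : v < a := by rw [Fin.lt_def]; omega
  have hav : Γ.Adj a v := h.isClique (Set.mem_Ici.2 hva.le) (Set.mem_Ici.2 le_rfl) hva.ne'
  have hG := isComponentOfDelete_setOf (Γ := Γ) (i := a) (x := Fin.last m) hcut.1.ne'
  have hvG : v ∈ {y | (isolate Γ a).Reachable (Fin.last m) y} :=
    Adj.reachable (G := isolate Γ a)
      ⟨(h.adj_last le_rfl h.lt_last.ne).symm, hcut.1.ne', hva.ne⟩
  exact h.lt_last.ne ((hG.isCutEdge_iff hΓ (Reachable.refl _) hcut.1).1 hcut v hvG hav)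

theorem IsEndClique.val_add_one_lt (h : IsEndClique Γ v) (hB : IsBlock Γ (Set.Ici v))
    (hBC : IsTypeB Γ ∨ IsTypeC Γ) : (v : ℕ) + 1 < m := by
  have hlt := h.lt_last
  rw [Fin.lt_def, Fin.val_last] at hlt
  by_contra hne
  have hvm : (v : ℕ) + 1 = m := by omega
  rcases hBC with ⟨a, b, ha, hb, -, hblock⟩ | ⟨a, b, ha, hb, -, hbc, -⟩
  · have hvb : v = b := by rw [Fin.ext_iff]; omega
    have hle := hB.le_of_ge hblock.prop (by
      rw [Ici_eq_pair hvm, hvb]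
      exact Set.subset_insert _ _)
    have := Set.mem_Ici.1 (hle (Set.mem_insert _ _))
    rw [Fin.le_def] at this
    omega
  · have hvb : v = b := by rw [Fin.ext_iff]; omega
    exact hbc (hvb ▸ h.isCutVertex)

/-- A vertex from `v` on is `n` or adjacent to `n`, so it cannot lie in a component missing `n`.
Below `v`, labels decrease with the distance from `n`, and `j` is closer to `n` than the vertices
cut off by it. -/
theorem IsEndClique.lt_of_mem (hΓ : Γ.Connected) (h : IsEndClique Γ v) {j x : Fin (m + 1)}
    {G : Set (Fin (m + 1))} (hG : IsComponentOfDelete Γ j G) (hL : Fin.last m ∉ G)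
    (hj : j ≠ Fin.last m) (hx : x ∈ G) : x < v ∧ j ≤ v ∧ x < j := by
  have hjc : IsCutVertex Γ j := isCutVertex_iff.2 ⟨x, Fin.last m, fun e => hG.notMem (e ▸ hx),
    hj.symm, fun h' => hL ((hG.mem_iff hx).2 h')⟩
  have hjv : j ≤ v := not_lt.1 fun h' => h.not_isCutVertex j h' hjc
  have hxv : x < v := by
    by_contra hxv
    have hxL : x ≠ Fin.last m := fun e => hL (e ▸ hx)
    exact hL (hG.mem_of_adj hx (h.adj_last (not_lt.1 hxv) hxL) hj.symm)
  refine ⟨hxv, hjv, ?_⟩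
  rcases hjv.eq_or_lt with rfl | hjv
  · exact hxv
  · exact h.lt_of_dist_lt j x hjv hxv (hG.dist_lt hΓ hL hx)

end NaturalLabelling

/-! ### Counting pendant components -/

section Counting

/-- The pairs of a vertex `i` and a component of `Γ - i` that does not contain the root `r`. -/
def pendants {n : ℕ} (Γ : SimpleGraph (Fin n)) (r : Fin n) : Finset (Fin n × Set (Fin n)) :=
  (Set.toFinite {π : Fin n × Set (Fin n) | IsComponentOfDelete Γ π.1 π.2 ∧ r ∉ π.2}).toFinset

/-- The size of the sets indexing the splines of a pendant pair. -/
def pendantSize {n : ℕ} (Γ : SimpleGraph (Fin n)) (π : Fin n × Set (Fin n)) : ℕ :=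
  (marked Γ π.1 π.2).card

/-! ### Pendant pairs in an arbitrary connected graph -/

section General

variable {n : ℕ} {Γ : SimpleGraph (Fin n)}

theorem mem_pendants {r : Fin n} {π : Fin n × Set (Fin n)} :
    π ∈ pendants Γ r ↔ IsComponentOfDelete Γ π.1 π.2 ∧ r ∉ π.2 := by
  unfold pendants
  rw [Set.Finite.mem_toFinset, Set.mem_ofPred_eq]

theorem finrank_splines_eq_sum_pendants (hΓ : Γ.Connected) (r : Fin n) :
    Module.finrank ℂ (splinesOfDegree Γ 1) =
      n + ∑ π ∈ pendants Γ r, (n.choose (pendantSize Γ π) - 1) := by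
  rw [finrank_splines_eq hΓ r]
  congr 1
  exact (Finset.sum_subtype _ (fun _ => mem_pendants)
    (fun π => n.choose (pendantSize Γ π) - 1)).symm

theorem pendantSize_pos (hΓ : Γ.Connected) {r : Fin n} {π : Fin n × Set (Fin n)}
    (hπ : π ∈ pendants Γ r) : 1 ≤ pendantSize Γ π :=
  Finset.card_pos.2 ⟨_, attach_mem_marked hΓ (mem_pendants.1 hπ).1⟩

theorem pendantSize_lt (hΓ : Γ.Connected) {r : Fin n} {π : Fin n × Set (Fin n)}
    (hπ : π ∈ pendants Γ r) : pendantSize Γ π < n := by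
  obtain ⟨h, hr⟩ := mem_pendants.1 hπ
  have hlt : marked Γ π.1 π.2 ⊂ Finset.univ := by
    refine Finset.ssubset_univ_iff.2 fun e => ?_
    exact notMem_marked hΓ h (e ▸ Finset.mem_univ _)
  have := Finset.card_lt_card hlt
  rwa [Finset.card_univ, Fintype.card_fin] at this

theorem isCutEdge_attach_iff (hΓ : Γ.Connected) {i : Fin n} {G : Set (Fin n)}
    (h : IsComponentOfDelete Γ i G) : IsCutEdge Γ i (attach Γ i G) ↔
      ∀ p ∈ G, ∀ q ∈ G, Γ.Adj i p → Γ.Adj i q → p = q := by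
  obtain ⟨hj, hij⟩ := h.attach_spec hΓ
  rw [h.isCutEdge_iff hΓ hj hij]
  exact ⟨fun hu p hp q hq hip hiq => (hu p hp hip).trans (hu q hq hiq).symm,
    fun hu q hq hiq => hu q hq _ hj hiq hij⟩

theorem pendantSize_of_isCutEdge {π : Fin n × Set (Fin n)}
    (h : IsCutEdge Γ π.1 (attach Γ π.1 π.2)) : pendantSize Γ π = π.2.ncard :=
  card_marked_of_isCutEdge h

theorem pendantSize_of_not_isCutEdge {π : Fin n × Set (Fin n)}
    (h : ¬ IsCutEdge Γ π.1 (attach Γ π.1 π.2)) : pendantSize Γ π = 1 := by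
  unfold pendantSize
  rw [marked_of_not_isCutEdge h, Finset.card_singleton]

/-- The only component is the complement of `r`. The contribution is the same in the cut and the
non-cut case, as `C(n, n - 1) = C(n, 1) = n`. -/
theorem sum_pendants_root (hn : 2 ≤ n) {r : Fin n} (hr : ¬ IsCutVertex Γ r) :
    ∑ π ∈ (pendants Γ r).filter (fun π => π.1 = r), (n.choose (pendantSize Γ π) - 1) = n - 1 := by
  have hreach : ∀ x y, x ≠ r → y ≠ r → (isolate Γ r).Reachable x y := by
    intro x y hx hy
    by_contra hn
    exact hr (isCutVertex_iff.2 ⟨x, y, hx, hy, hn⟩)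
  have heq : (pendants Γ r).filter (fun π => π.1 = r) = {(r, {r}ᶜ)} := by
    ext ⟨i, G⟩
    rw [Finset.mem_filter, mem_pendants, Finset.mem_singleton, Prod.mk.injEq]
    constructor
    · rintro ⟨⟨hG, -⟩, rfl⟩
      refine ⟨rfl, ?_⟩
      obtain ⟨x, hx⟩ := hG.nonempty
      ext y
      rw [Set.mem_compl_iff, Set.mem_singleton_iff]
      exact ⟨fun hy e => hG.notMem (e ▸ hy), fun hy => (hG.mem_iff hx).2
        (hreach x y (hG.ne_of_mem hx) hy)⟩
    · rintro ⟨rfl, rfl⟩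
      refine ⟨⟨?_, by simp⟩, rfl⟩
      obtain ⟨x, hx⟩ : ∃ x, x ≠ i := by
        have := Fin.nontrivial_iff_two_le.2 hn
        exact exists_ne i
      refine isComponentOfDelete_iff.2 ⟨x, hx, ?_⟩
      ext y
      exact ⟨fun hy => hreach x y hx hy, fun hy => Reachable.ne_of_isolate hy hx⟩
  rw [heq, Finset.sum_singleton]
  by_cases hc : IsCutEdge Γ r (attach Γ r {r}ᶜ)
  · rw [pendantSize_of_isCutEdge (π := (r, {r}ᶜ)) hc, Set.ncard_compl, Set.ncard_singleton,
      Nat.card_eq_fintype_card, Fintype.card_fin, Nat.choose_symm (by omega), Nat.choose_one_right]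
  · rw [pendantSize_of_not_isCutEdge (π := (r, {r}ᶜ)) hc, Nat.choose_one_right]

end General

variable {m : ℕ} {Γ : SimpleGraph (Fin (m + 1))} {v : Fin (m + 1)}

/-- If a component `G` of `Γ - j` is attached by a cut edge, its end in `G` is closer to the root
than the other vertices of `G`. -/
theorem dist_attach_lt {n : ℕ} {Γ : SimpleGraph (Fin n)} {r j x : Fin n} {G : Set (Fin n)}
    (hΓ : Γ.Connected) (hG : IsComponentOfDelete Γ j G) (hr : r ∉ G)
    (hc : IsCutEdge Γ j (attach Γ j G)) (hx : x ∈ G) (hne : x ≠ attach Γ j G) :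
    Γ.dist (attach Γ j G) r < Γ.dist x r := by
  refine dist_lt_of_not_reachable_isolate hΓ hne ?_
  rintro ⟨p⟩
  obtain ⟨hj, hij⟩ := hG.attach_spec hΓ
  have key : ∀ {y z : Fin n}, (isolate Γ (attach Γ j G)).Walk y z → y ∈ G → z ∈ G := by
    intro y z q
    induction q with
    | nil => exact id
    | @cons y t z hyt q ih =>
      intro hy
      refine ih (hG.mem_of_adj hy hyt.1 ?_)
      rintro rfl
      exact hyt.2.1 ((hG.isCutEdge_iff hΓ hj hij).1 hc y hy hyt.1.symm)
  exact hr (key p hx)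

/-- If `G` hangs from a cut edge, its end in `G` is the vertex of `G` closest to `n`, hence the one
with the largest label. So the dominant pair is that very edge. -/
theorem IsEndClique.isCutEdge_iff (hΓ : Γ.Connected) (h : IsEndClique Γ v) {i j : Fin (m + 1)}
    {G : Set (Fin (m + 1))} (hG : IsComponentOfDelete Γ j G) (hL : Fin.last m ∉ G)
    (hj : j ≠ Fin.last m) (hi : IsGreatest G i) :
    IsCutEdge Γ i j ↔ IsCutEdge Γ j (attach Γ j G) := by
  obtain ⟨ha, hja⟩ := hG.attach_spec hΓ
  constructor
  · intro hc
    rw [isCutEdge_comm] at hc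
    have := (hG.isCutEdge_iff hΓ hi.1 hc.1).1 hc _ ha hja
    rwa [this]
  · intro hc
    by_cases hia : i = attach Γ j G
    · rw [isCutEdge_comm, hia]
      exact hc
    · exfalso
      have h1 := dist_attach_lt hΓ hG hL hc hi.1 hia
      have h2 := h.lt_of_dist_lt _ _ (h.lt_of_mem hΓ hG hL hj ha).1
        (h.lt_of_mem hΓ hG hL hj hi.1).1 h1
      exact absurd (hi.2 ha) (not_le.2 h2)

theorem componentOfDelete_eq {n : ℕ} {Γ : SimpleGraph (Fin n)} {i j : Fin n} {G : Set (Fin n)}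
    (hG : IsComponentOfDelete Γ j G) (hi : i ∈ G) : componentOfDelete Γ j i = G := by
  ext k
  rw [mem_componentOfDelete (hG.ne_of_mem hi), hG.mem_iff hi]

-- A component missing `n` corresponds to the pair formed by its largest vertex and the vertex it
-- hangs from. Weak pairs have a marked set of size `1`, and their count is absorbed through `C(m,
-- 0) = 1`.
open Classical in
theorem strongTerm_add_weakTerm (hΓ : Γ.Connected) (h : IsEndClique Γ v) :
    strongTerm Γ + weakTerm Γ =
      ∑ π ∈ (pendants Γ (Fin.last m)).filter (fun π => π.1 ≠ Fin.last m),
        m.choose (pendantSize Γ π - 1) := by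
  have hs : strongTerm Γ = ∑ p ∈ (Finset.univ.filter fun p : Fin (m + 1) × Fin (m + 1) =>
      IsDominantPair Γ p.1 p.2).filter (fun p => IsCutEdge Γ p.1 p.2),
      m.choose ((componentOfDelete Γ p.2 p.1).ncard - 1) := by
    unfold strongTerm
    rw [← finsum_mem_coe_finset]
    refine finsum_mem_congr ?_ fun _ _ => rfl
    ext p
    simp [IsStronglyDominant]
  have hw : weakTerm Γ = ∑ p ∈ (Finset.univ.filter fun p : Fin (m + 1) × Fin (m + 1) =>
      IsDominantPair Γ p.1 p.2).filter (fun p => ¬ IsCutEdge Γ p.1 p.2), 1 := by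
    unfold weakTerm
    rw [← Finset.card_eq_sum_ones, ← Set.ncard_coe_finset]
    congr 1
    ext p
    simp [IsWeaklyDominant]
  rw [hs, hw, ← Finset.sum_ite]
  refine Finset.sum_nbij (fun p => (p.2, componentOfDelete Γ p.2 p.1)) ?_ ?_ ?_ ?_
  · intro p hp
    obtain ⟨hc, hlt, G, hG, hL, hi⟩ := (Finset.mem_filter.1 hp).2
    rw [Finset.mem_filter, mem_pendants, componentOfDelete_eq hG hi.1]
    refine ⟨⟨hG, hL⟩, fun e => h.not_isCutVertex _ h.lt_last ?_⟩
    simp only at e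
    rwa [← e]
  · intro p hp q hq hpq
    obtain ⟨-, -, G, hG, -, hi⟩ := (Finset.mem_filter.1 hp).2
    obtain ⟨-, -, G', hG', -, hi'⟩ := (Finset.mem_filter.1 hq).2
    simp only [componentOfDelete_eq hG hi.1, componentOfDelete_eq hG' hi'.1, Prod.mk.injEq] at hpq
    refine Prod.ext ?_ hpq.1
    rw [hpq.2] at hi
    exact hi.unique hi'
  · rintro ⟨j, G⟩ hπ
    rw [Finset.mem_coe, Finset.mem_filter, mem_pendants] at hπ
    obtain ⟨⟨hG, hL⟩, hj⟩ := hπ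
    simp only at hG hL hj
    obtain ⟨i, hi⟩ : ∃ i, IsGreatest G i := by
      obtain ⟨i, hi, hmax⟩ := Set.exists_max_image G id (Set.toFinite G) hG.nonempty
      exact ⟨i, hi, hmax⟩
    refine ⟨(i, j), ?_, ?_⟩
    · rw [Finset.mem_coe, Finset.mem_filter]
      refine ⟨Finset.mem_univ _, ?_, (h.lt_of_mem hΓ hG hL hj hi.1).2.2, G, hG, hL, hi⟩
      exact isCutVertex_iff.2 ⟨i, Fin.last m, hG.ne_of_mem hi.1, Ne.symm hj,
        fun h' => hL ((hG.mem_iff hi.1).2 h')⟩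
    · simp only [componentOfDelete_eq hG hi.1]
  · intro p hp
    obtain ⟨hc, hlt, G, hG, hL, hi⟩ := (Finset.mem_filter.1 hp).2
    have hj : p.2 ≠ Fin.last m := fun e => h.not_isCutVertex _ h.lt_last (e ▸ hc)
    simp only [componentOfDelete_eq hG hi.1]
    have hiff := h.isCutEdge_iff hΓ hG hL hj hi
    by_cases hcut : IsCutEdge Γ p.1 p.2
    · rw [if_pos hcut, pendantSize_of_isCutEdge (π := (p.2, G)) (hiff.1 hcut)]
    · rw [if_neg hcut, pendantSize_of_not_isCutEdge (π := (p.2, G)) (fun h' => hcut (hiff.2 h')),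
        Nat.sub_self, Nat.choose_zero_right]

/-! ### Removing the last vertex -/

/-- Removing a vertex whose neighbours are pairwise adjacent does not affect reachability. -/
theorem reachable_comap_castSucc_iff {H : SimpleGraph (Fin (m + 1))}
    (hs : ∀ p q, H.Adj (Fin.last m) p → H.Adj (Fin.last m) q → p ≠ q → H.Adj p q) {x y : Fin m} :
    (H.comap Fin.castSucc).Reachable x y ↔ H.Reachable x.castSucc y.castSucc := by
  constructor
  · intro h
    exact h.map (⟨Fin.castSucc, fun hab => hab⟩ : H.comap Fin.castSucc →g H)
  · rintro ⟨p⟩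
    -- While the walk stands at the last vertex, `x` is a neighbour of that vertex, kept as a
    -- substitute; the next vertex equals `x` or is adjacent to it.
    have key : ∀ {z t : Fin (m + 1)}, H.Walk z t → t = y.castSucc → ∀ x : Fin m,
        (z = x.castSucc ∨ (z = Fin.last m ∧ H.Adj (Fin.last m) x.castSucc)) →
        (H.comap Fin.castSucc).Reachable x y := by
      intro z t q
      induction q with
      | nil =>
        rintro rfl x (h | h)
        · rw [Fin.castSucc_injective m h]
        · exact absurd h.1 (Fin.castSucc_lt_last y).ne
      | @cons z z₂ t hz q ih =>
        rintro ht x (rfl | ⟨rfl, hx⟩)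
        · rcases Fin.eq_castSucc_or_eq_last z₂ with ⟨x₂, rfl⟩ | rfl
          · have hadj : (H.comap Fin.castSucc).Adj x x₂ := hz
            exact hadj.reachable.trans (ih ht x₂ (Or.inl rfl))
          · exact ih ht x (Or.inr ⟨rfl, hz.symm⟩)
        · rcases Fin.eq_castSucc_or_eq_last z₂ with ⟨x₂, rfl⟩ | rfl
          · by_cases hxx : x = x₂
            · subst hxx
              exact ih ht x (Or.inl rfl)
            · have hadj : (H.comap Fin.castSucc).Adj x x₂ :=
                hs _ _ hx hz fun e => hxx (Fin.castSucc_injective m e)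
              exact hadj.reachable.trans (ih ht x₂ (Or.inl rfl))
          · exact absurd hz (H.irrefl)
    exact key p rfl x (Or.inl rfl)

theorem IsEndClique.adj_of_adj_last (h : IsEndClique Γ v) {p q : Fin (m + 1)}
    (hp : Γ.Adj (Fin.last m) p) (hq : Γ.Adj (Fin.last m) q) (hpq : p ≠ q) : Γ.Adj p q :=
  h.isClique (h.le_of_adj _ _ h.lt_last hp) (h.le_of_adj _ _ h.lt_last hq) hpq

theorem IsEndClique.reachable_isolate_iff (h : IsEndClique Γ v) {i x y : Fin m} :
    (isolate (deleteLast Γ) i).Reachable x y ↔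
      (isolate Γ i.castSucc).Reachable x.castSucc y.castSucc := by
  rw [← reachable_comap_castSucc_iff]
  · have : isolate (deleteLast Γ) i = (isolate Γ i.castSucc).comap Fin.castSucc := by
      ext a b
      simp [isolate_adj, deleteLast]
    rw [this]
  · intro p q hp hq hpq
    exact ⟨h.adj_of_adj_last hp.1 hq.1 hpq, hp.2.2, hq.2.2⟩

theorem IsEndClique.connected_deleteLast (hΓ : Γ.Connected) (h : IsEndClique Γ v) :
    (deleteLast Γ).Connected := by
  have hlt := h.lt_last
  rw [Fin.lt_def, Fin.val_last] at hlt
  have : Nonempty (Fin m) := ⟨⟨0, by omega⟩⟩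
  refine ⟨fun x y => ?_⟩
  have hs := fun p q => h.adj_of_adj_last (p := p) (q := q)
  exact (reachable_comap_castSucc_iff hs).2 (hΓ.preconnected _ _)

theorem IsEndClique.isComponentOfDelete_preimage (h : IsEndClique Γ v) {i : Fin m}
    {G : Set (Fin (m + 1))} (hG : IsComponentOfDelete Γ i.castSucc G) {x : Fin m}
    (hx : x.castSucc ∈ G) :
    IsComponentOfDelete (deleteLast Γ) i (Fin.castSucc ⁻¹' G) := by
  refine isComponentOfDelete_iff.2 ⟨x, ?_, ?_⟩
  · rintro rfl
    exact hG.notMem hx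
  · ext y
    rw [Set.mem_preimage, hG.mem_iff hx, Set.mem_ofPred_eq, h.reachable_isolate_iff]

theorem IsEndClique.exists_isComponentOfDelete (h : IsEndClique Γ v) {i : Fin m}
    {G' : Set (Fin m)} (hG' : IsComponentOfDelete (deleteLast Γ) i G') :
    ∃ G, IsComponentOfDelete Γ i.castSucc G ∧ Fin.castSucc ⁻¹' G = G' := by
  obtain ⟨x, hx⟩ := hG'.nonempty
  have hxi : x.castSucc ≠ i.castSucc := fun e =>
    hG'.notMem (Fin.castSucc_injective m e ▸ hx)
  refine ⟨_, isComponentOfDelete_setOf hxi, ?_⟩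
  ext y
  rw [Set.mem_preimage, Set.mem_ofPred_eq, ← h.reachable_isolate_iff, hG'.mem_iff hx]

/-- Being attached by a cut edge means having a unique neighbour of `i` in `G`. This criterion does
not depend on the chosen neighbour and does not see the vertex `n ∉ G`. -/
theorem IsEndClique.pendantSize_preimage (hΓ : Γ.Connected) (h : IsEndClique Γ v) {i : Fin m}
    {G : Set (Fin (m + 1))} (hG : IsComponentOfDelete Γ i.castSucc G) (hL : Fin.last m ∉ G) :
    pendantSize (deleteLast Γ) (i, Fin.castSucc ⁻¹' G) = pendantSize Γ (i.castSucc, G) := by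
  have hsub : ∀ p ∈ G, ∃ p', Fin.castSucc p' = p := by
    intro p hp
    rcases Fin.eq_castSucc_or_eq_last p with ⟨p', rfl⟩ | rfl
    · exact ⟨p', rfl⟩
    · exact absurd hp hL
  obtain ⟨x, hx⟩ := hG.nonempty
  obtain ⟨x, rfl⟩ := hsub x hx
  have hG' := h.isComponentOfDelete_preimage hG hx
  have hiff : IsCutEdge (deleteLast Γ) i (attach (deleteLast Γ) i (Fin.castSucc ⁻¹' G)) ↔
      IsCutEdge Γ i.castSucc (attach Γ i.castSucc G) := by
    rw [isCutEdge_attach_iff (h.connected_deleteLast hΓ) hG', isCutEdge_attach_iff hΓ hG]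
    constructor
    · intro hu p hp q hq hip hiq
      obtain ⟨p, rfl⟩ := hsub p hp
      obtain ⟨q, rfl⟩ := hsub q hq
      rw [hu p hp q hq hip hiq]
    · intro hu p hp q hq hip hiq
      exact Fin.castSucc_injective m (hu _ hp _ hq hip hiq)
  by_cases hc : IsCutEdge Γ i.castSucc (attach Γ i.castSucc G)
  · rw [pendantSize_of_isCutEdge (π := (i, Fin.castSucc ⁻¹' G)) (hiff.2 hc),
      pendantSize_of_isCutEdge (π := (i.castSucc, G)) hc]
    exact Set.ncard_preimage_of_injective_subset_range (Fin.castSucc_injective m) hsub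
  · rw [pendantSize_of_not_isCutEdge (π := (i, Fin.castSucc ⁻¹' G)) (fun h' => hc (hiff.1 h')),
      pendantSize_of_not_isCutEdge (π := (i.castSucc, G)) hc]

open Classical in
/-- Sums over the pendant components of `Γ` and of `Γ - n`, at the vertices in a set `Q`. -/
theorem IsEndClique.sum_pendants_deleteLast (hΓ : Γ.Connected) (h : IsEndClique Γ v) {a : Fin m}
    (ha : Γ.Adj a.castSucc (Fin.last m)) (Q : Set (Fin m))
    (hQ : ∀ i ∈ Q, i = a → ∀ x, x ≠ a →
      ¬ (isolate Γ a.castSucc).Reachable x.castSucc (Fin.last m)) (f : ℕ → ℕ) :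
    ∑ π ∈ (pendants Γ (Fin.last m)).filter (fun π => π.1 ∈ Fin.castSucc '' Q),
        f (pendantSize Γ π) =
      ∑ π ∈ (pendants (deleteLast Γ) a).filter (fun π => π.1 ∈ Q),
        f (pendantSize (deleteLast Γ) π) := by
  symm
  have hlift : ∀ π ∈ (pendants (deleteLast Γ) a).filter (fun π => π.1 ∈ Q),
      ∃ G, IsComponentOfDelete Γ π.1.castSucc G ∧ Fin.last m ∉ G ∧
        Fin.castSucc ⁻¹' G = π.2 := by
    rintro ⟨i, G'⟩ hπ
    rw [Finset.mem_filter, mem_pendants] at hπ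
    obtain ⟨⟨hG', haG⟩, hi⟩ := hπ
    simp only at hG' haG hi
    obtain ⟨G, hG, rfl⟩ := h.exists_isComponentOfDelete hG'
    refine ⟨G, hG, fun hL => ?_, rfl⟩
    -- For `i ≠ a`, the vertices `a` and `n` lie in the same component of `Γ - i`, so missing one is
    -- missing the other. Only at `i = a` is `hQ` required.
    by_cases hia : i = a
    · obtain ⟨x, hx⟩ := hG'.nonempty
      subst hia
      exact hQ i hi rfl x (hG'.ne_of_mem hx) ((hG.mem_iff hx).1 hL)
    · exact haG (hG.mem_of_adj hL ha.symm fun e => hia (Fin.castSucc_injective m e).symm)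
  have hrange : ∀ G : Set (Fin (m + 1)), Fin.last m ∉ G →
      Fin.castSucc '' (Fin.castSucc ⁻¹' G) = G := by
    intro G hL
    rw [Set.image_preimage_eq_iff]
    intro p hp
    rcases Fin.eq_castSucc_or_eq_last p with ⟨p', rfl⟩ | rfl
    · exact ⟨p', rfl⟩
    · exact absurd hp hL
  refine Finset.sum_nbij (fun π => (π.1.castSucc, Fin.castSucc '' π.2)) ?_ ?_ ?_ ?_
  · intro π hπ
    obtain ⟨G, hG, hL, hGπ⟩ := hlift π hπ
    rw [Finset.mem_filter, mem_pendants, ← hGπ, hrange G hL]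
    exact ⟨⟨hG, hL⟩, π.1, (Finset.mem_filter.1 hπ).2, rfl⟩
  · intro π hπ π' hπ' e
    simp only [Prod.mk.injEq] at e
    exact Prod.ext (Fin.castSucc_injective m e.1)
      ((Fin.castSucc_injective m).image_injective e.2)
  · rintro ⟨j, G⟩ hπ
    rw [Finset.mem_coe, Finset.mem_filter, mem_pendants] at hπ
    obtain ⟨⟨hG, hL⟩, i, hi, hij⟩ := hπ
    simp only at hG hL hij
    subst hij
    refine ⟨(i, Fin.castSucc ⁻¹' G), ?_, ?_⟩
    · rw [Finset.mem_coe, Finset.mem_filter, mem_pendants]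
      obtain ⟨x, hx⟩ := hG.nonempty
      rw [← hrange G hL] at hx
      obtain ⟨x, hx, rfl⟩ := hx
      refine ⟨⟨h.isComponentOfDelete_preimage hG hx, fun haG => ?_⟩, hi⟩
      exact hL (hG.mem_of_adj haG ha (Fin.castSucc_lt_last i).ne')
    · simp only [hrange G hL]
  · intro π hπ
    obtain ⟨G, hG, hL, hGπ⟩ := hlift π hπ
    obtain ⟨i, G'⟩ := π
    simp only at hG hGπ
    subst hGπ
    simp only [hrange G hL]
    rw [h.pendantSize_preimage hΓ hG hL]

end Counting

/-! ### The recursion for the dimension -/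

section Recursion

variable {m : ℕ} {Γ : SimpleGraph (Fin (m + 1))} {v : Fin (m + 1)}

theorem choose_succ_sub_one {m c : ℕ} (h1 : 1 ≤ c) (h2 : c ≤ m) :
    (m + 1).choose c - 1 = m.choose (c - 1) + (m.choose c - 1) := by
  obtain ⟨c, rfl⟩ : ∃ d, c = d + 1 := ⟨c - 1, by omega⟩
  have := Nat.choose_pos h2
  rw [Nat.choose_succ_succ', Nat.add_sub_cancel]
  omega

theorem IsEndClique.finrank_eq (hΓ : Γ.Connected) (h : IsEndClique Γ v) :
    Module.finrank ℂ (splinesOfDegree Γ 1) =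
      (m + 1) + m + (strongTerm Γ + weakTerm Γ) +
        ∑ π ∈ (pendants Γ (Fin.last m)).filter (fun π => π.1 ≠ Fin.last m),
          (m.choose (pendantSize Γ π) - 1) := by
  have hlt := h.lt_last
  rw [Fin.lt_def, Fin.val_last] at hlt
  have hsum : ∑ π ∈ (pendants Γ (Fin.last m)).filter (fun π => ¬ π.1 = Fin.last m),
      ((m + 1).choose (pendantSize Γ π) - 1) = strongTerm Γ + weakTerm Γ +
        ∑ π ∈ (pendants Γ (Fin.last m)).filter (fun π => π.1 ≠ Fin.last m),
          (m.choose (pendantSize Γ π) - 1) := by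
    rw [strongTerm_add_weakTerm hΓ h, ← Finset.sum_add_distrib]
    refine Finset.sum_congr rfl fun π hπ => ?_
    have hπ' := (Finset.mem_filter.1 hπ).1
    exact choose_succ_sub_one (pendantSize_pos hΓ hπ')
      (Nat.lt_succ_iff.1 (pendantSize_lt hΓ hπ'))
  rw [finrank_splines_eq_sum_pendants hΓ (Fin.last m),
    ← Finset.sum_filter_add_sum_filter_not _ (fun π => π.1 = Fin.last m),
    sum_pendants_root (by omega) (h.not_isCutVertex _ h.lt_last), hsum, Nat.add_sub_cancel]
  ring

open Classical in
theorem filter_ne_last_eq (S : Finset (Fin (m + 1) × Set (Fin (m + 1)))) :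
    S.filter (fun π => π.1 ≠ Fin.last m) =
      S.filter (fun π => π.1 ∈ Fin.castSucc '' (Set.univ : Set (Fin m))) := by
  refine Finset.filter_congr fun π _ => ?_
  rw [Set.image_univ, Fin.range_castSucc, Set.mem_ofPred_eq, Fin.ne_iff_vne, Fin.val_last]
  have := π.1.2
  omega

theorem IsEndClique.finrank_eq_of_val_add_one_eq (hΓ : Γ.Connected) (h : IsEndClique Γ v)
    (hv : (v : ℕ) + 1 = m) :
    Module.finrank ℂ (splinesOfDegree Γ 1) =
      1 + Module.finrank ℂ (splinesOfDegree (deleteLast Γ) 1) + m.choose 1 + strongTerm Γ +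
        weakTerm Γ := by
  obtain ⟨a, rfl⟩ : ∃ a : Fin m, v = a.castSucc := ⟨⟨v, by omega⟩, rfl⟩
  have ha := h.adj_last le_rfl h.lt_last.ne
  -- Root `Γ - n` at `v`, the only neighbour of `n`. Its pendant pairs are then exactly those of `Γ`
  -- away from `n`, and the surplus is `(m + 1) + m - m = 1 + m`.
  have hsum := h.sum_pendants_deleteLast hΓ ha Set.univ ?_ (fun c => m.choose c - 1)
  · rw [h.finrank_eq hΓ, finrank_splines_eq_sum_pendants (h.connected_deleteLast hΓ) a,
      filter_ne_last_eq, hsum, Nat.choose_one_right]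
    simp only [Set.mem_univ, Finset.filter_true]
    ring
  · intro i _ _ x hx hr
    obtain ⟨p⟩ := hr.symm
    generalize hy : x.castSucc = y at p
    cases p with
    | nil => exact (Fin.castSucc_lt_last x).ne hy
    | @cons _ z _ hz p =>
      have h1 := h.le_of_adj _ z h.lt_last hz.1
      have h2 : z ∈ ({a.castSucc, Fin.last m} : Set (Fin (m + 1))) :=
        Ici_eq_pair hv ▸ Set.mem_Ici.2 h1
      rcases h2 with rfl | rfl
      · exact hz.2.2 rfl
      · exact Γ.irrefl hz.1

theorem IsEndClique.finrank_eq_of_val_add_one_lt (hΓ : Γ.Connected) (h : IsEndClique Γ v)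
    (hv : (v : ℕ) + 1 < m) :
    Module.finrank ℂ (splinesOfDegree Γ 1) =
      1 + Module.finrank ℂ (splinesOfDegree (deleteLast Γ) 1) + 1 + strongTerm Γ +
        weakTerm Γ := by
  classical
  -- Root `Γ - n` at the label `n - 1`, which is not a cut vertex of either graph. It carries no
  -- pendant pair in `Γ` but contributes `m - 1` in `Γ - n`, so the surplus is `(m + 1) + m - m - (m
  -- - 1) = 2`.
  let a : Fin m := ⟨m - 1, by omega⟩
  have hva : v < a.castSucc := by
    rw [Fin.lt_def]
    simp only [a, Fin.val_castSucc]
    omega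
  have ha : Γ.Adj a.castSucc (Fin.last m) := h.adj_last hva.le (Fin.castSucc_lt_last a).ne
  have hac := h.not_isCutVertex _ hva
  have hac' : ¬ IsCutVertex (deleteLast Γ) a := by
    rw [isCutVertex_iff]
    rintro ⟨x, y, hx, hy, hn⟩
    rw [h.reachable_isolate_iff] at hn
    exact hac (isCutVertex_iff.2 ⟨_, _, fun e => hx (Fin.castSucc_injective m e),
      fun e => hy (Fin.castSucc_injective m e), hn⟩)
  have hsum := h.sum_pendants_deleteLast hΓ ha {i | i ≠ a} (fun i hi e => absurd e hi)
    (fun c => m.choose c - 1)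
  have hfilter : (pendants Γ (Fin.last m)).filter (fun π => π.1 ≠ Fin.last m) =
      (pendants Γ (Fin.last m)).filter (fun π => π.1 ∈ Fin.castSucc '' {i | i ≠ a}) := by
    refine Finset.filter_congr fun π hπ => ?_
    obtain ⟨hG, hL⟩ := mem_pendants.1 hπ
    constructor
    · intro hne
      rcases Fin.eq_castSucc_or_eq_last π.1 with ⟨i, hi⟩ | hi
      · refine ⟨i, ?_, hi.symm⟩
        rintro rfl
        obtain ⟨x, hx⟩ := hG.nonempty
        refine hac (isCutVertex_iff.2 ⟨x, Fin.last m, hi ▸ hG.ne_of_mem hx,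
          (Fin.castSucc_lt_last _).ne', fun h' => hL ((hG.mem_iff hx).2 (hi ▸ h'))⟩)
      · exact absurd hi hne
    · rintro ⟨i, -, hi⟩ e
      exact (Fin.castSucc_lt_last i).ne (hi.trans e)
  have hroot := sum_pendants_root (by omega) hac'
  have hsplit := Finset.sum_filter_add_sum_filter_not (pendants (deleteLast Γ) a)
    (fun π => π.1 = a) (fun π => m.choose (pendantSize (deleteLast Γ) π) - 1)
  simp only [Set.mem_ofPred_eq] at hsum
  rw [h.finrank_eq hΓ, finrank_splines_eq_sum_pendants (h.connected_deleteLast hΓ) a, hfilter]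
  rw [hsum, ← hsplit, hroot]
  simp only [ne_eq]
  omega

end Recursion

end CayleySplines

end

theorem mainTheorem5 (m : ℕ) (Γ : SimpleGraph (Fin (m + 1))) (hΓ : Γ.Connected) :
    Submodule.span ℂ (CayleySplines.linearGenerators Γ) = CayleySplines.splinesOfDegree Γ 1 ∧
    (CayleySplines.IsCliqued Γ → CayleySplines.IsNaturallyLabelled Γ →
      (CayleySplines.IsTypeA Γ ∨ CayleySplines.IsTypeB Γ ∨ CayleySplines.IsTypeC Γ) ∧
      (CayleySplines.IsTypeA Γ →
        Module.finrank ℂ (CayleySplines.splinesOfDegree Γ 1) =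
          1 + Module.finrank ℂ
              (CayleySplines.splinesOfDegree (CayleySplines.deleteLast Γ) 1) +
            m.choose 1 + CayleySplines.strongTerm Γ + CayleySplines.weakTerm Γ) ∧
      (CayleySplines.IsTypeB Γ ∨ CayleySplines.IsTypeC Γ →
        Module.finrank ℂ (CayleySplines.splinesOfDegree Γ 1) =
          1 + Module.finrank ℂ
              (CayleySplines.splinesOfDegree (CayleySplines.deleteLast Γ) 1) +
            1 + CayleySplines.strongTerm Γ + CayleySplines.weakTerm Γ)) := by
  refine ⟨CayleySplines.span_linearGenerators hΓ, fun hc hn => ?_⟩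
  obtain ⟨v, hv, hB, hA⟩ := hn.exists_isEndClique hΓ hc
  refine ⟨?_, fun h => hv.finrank_eq_of_val_add_one_eq hΓ (hv.val_add_one_eq hΓ h),
    fun h => hv.finrank_eq_of_val_add_one_lt hΓ (hv.val_add_one_lt hB h)⟩
  have hlt : (v : ℕ) < m := hv.lt_last
  rcases (show (v : ℕ) + 1 = m ∨ (v : ℕ) + 2 = m ∨ (v : ℕ) + 2 < m by omega) with h | h | h
  · exact Or.inl (hA h)
  · exact Or.inr (Or.inl (hv.isTypeB hB h))
  · exact Or.inr (Or.inr (hv.isTypeC h))
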